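/- Let $(M,g)$ be a smooth (Hausdorff) Riemannian manifold without boundary of dimension $d$, with Levi-Civita connection $\nabla$, and let $E\to M$ be a smooth complex vector bundle of finite rank. Let $\gamma:TM\to\mathrm{End}(E)$ be a Clifford module structure, i.e. a smooth real-linear bundle map with $\gamma(X)\gamma(Y)+\gamma(Y)\gamma(X)=-2g(X,Y)\,\mathrm{Id}_E$ (equivalently, a unital algebra morphism from the Clifford algebra bundle of $(TM,-g)$ to $\mathrm{End}(E)$), and let $\widetilde\nabla$ be a smooth connection on $E$ compatible with $\gamma$, i.e. $\widetilde\nabla_X(\gamma(Y)\phi)=\gamma(\nabla_XY)\phi+\gamma(Y)\widetilde\nabla_X\phi$ for all vector fields $X,Y$ and sections $\phi$ of $E$. Let $\psi\in C^\infty(M;\mathrm{End}(E))$ and $D=\gamma\widetilde\nabla+\psi$, that is, $D\phi=\sum_k\gamma(e_k)\widetilde\nabla_{e_k}\phi+\psi\phi$ with $(e_k)$ an orthonormal basis of $T_xM$ at each point $x$. Put $$L(X)=\tfrac12\big(\gamma(X)\psi+\psi\gamma(X)\big),\qquad \nabla_\psi=\widetilde\nabla-L .$$ Then $\nabla_\psi$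 is a smooth connection on $E$, and there is a smooth endomorphism $V_\psi\in C^\infty(M;\mathrm{End}(E))$ such that $$D^2=\Delta^{\nabla_\psi}+V_\psi\quad\text{on } C^\infty(M;E).$$ Here, for a connection $\widehat\nabla$ on $E$, the connection Laplacian $\Delta^{\widehat\nabla}$ is the operator given in local coordinates by $-g^{ij}(\widehat\nabla_{\partial_i}\widehat\nabla_{\partial_j}-\Gamma_{ij}^k\widehat\nabla_{\partial_k})$, where $\nabla_{\partial_i}\partial_j=\Gamma_{ij}^k\partial_k$; the operator $\Delta^{\nabla_\psi}$ does not depend on the choice of coordinates. Moreover, in every smooth coordinate chart, $$V_\psi=\tfrac12\gamma^i\gamma^jR^{\widetilde\nabla}_{ij}+\tfrac12[\gamma^i,\overline\nabla_i\psi]+L^iL_i+\psi^2 ,$$ where repeated indices are summed, $U_i=U(\partial_i)$ and $U^i=U(g^{ij}\partial_j)$ for $U=\gamma,L$, $\overline\nabla_i=\overline\nabla_{\partial_i}$, $R^{\widetilde\nabla}_{XY}=[\widetilde\nabla_X,\widetilde\nabla_Y]-\widetilde\nabla_{[X,Y]}$ with $R^{\widetilde\nabla}_{ij}=R^{\widetilde\nabla}_{\partial_i\partial_j}$,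 and $\overline\nabla$ is the connection on $\mathrm{End}(E)$ given by $(\overline\nabla_X\omega)(\phi)=\widetilde\nabla_X(\omega\phi)-\omega(\widetilde\nabla_X\phi)$. -/

import Mathlib

open Bundle VectorField FiberBundle
open scoped Manifold ContDiff

noncomputable section

/-! ### Complex vector bundles as real vector bundles -/

section ComplexToReal

instance (priority := 100) instContinuousSMulRealOfComplex (V : Type*) [TopologicalSpace V]
    [AddCommGroup V] [Module ℂ V] [ContinuousSMul ℂ V] : ContinuousSMul ℝ V where
  continuous_smul :=
    (continuous_smul (M := ℂ) (X := V)).comp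
      ((Complex.continuous_ofReal.comp continuous_fst).prodMk continuous_snd)

/-- The real vector bundle underlying a complex vector bundle. -/
instance (priority := 100) instVectorBundleRealOfComplex {B : Type*} [TopologicalSpace B]
    (F : Type*) [NormedAddCommGroup F] [NormedSpace ℂ F] (E : B → Type*)
    [TopologicalSpace (TotalSpace F E)] [∀ x, AddCommGroup (E x)] [∀ x, Module ℂ (E x)]
    [∀ x, TopologicalSpace (E x)] [FiberBundle F E] [VectorBundle ℂ F E] :
    VectorBundle ℝ F E where
  trivialization_linear' e he :=
    ⟨fun b hb ↦ ((e.linear ℂ hb).mk' _ ).restrictScalars ℝ |>.isLinear⟩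
  continuousOn_coordChange' e e' he he' := by
    have hl (e : Trivialization F (π F E)) [MemTrivializationAtlas e] : e.IsLinear ℝ :=
      ⟨fun b hb ↦ ((e.linear ℂ hb).mk' _ ).restrictScalars ℝ |>.isLinear⟩
    have h := continuousOn_coordChange ℂ e e'
    have h2 := (ContinuousLinearMap.restrictScalarsL ℂ F F ℝ ℝ).continuous.comp_continuousOn h
    refine h2.congr fun b hb ↦ ?_
    ext v
    simp [Trivialization.coordChangeL_apply _ _ hb]

end ComplexToReal

/-! ### The Levi-Civita connection -/

section LeviCivita

/-- Right-hand side of the Koszul formula for `2 ⟨∇_X Y, Z⟩` at `x`. -/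
def koszul {E : Type*} [NormedAddCommGroup E] [NormedSpace ℝ E]
    {H : Type*} [TopologicalSpace H] (I : ModelWithCorners ℝ E H)
    {M : Type*} [TopologicalSpace M] [ChartedSpace H M]
    [IsManifold I ∞ M] [RiemannianBundle (fun x : M ↦ TangentSpace I x)]
    (X Y Z : Π x : M, TangentSpace I x) (x : M) : ℝ :=
  d% (fun y ↦ inner ℝ (Y y) (Z y)) x (X x) + d% (fun y ↦ inner ℝ (X y) (Z y)) x (Y x)
    - d% (fun y ↦ inner ℝ (X y) (Y y)) x (Z x)
    + inner ℝ (mlieBracket I X Y x) (Z x) - inner ℝ (mlieBracket I X Z x) (Y x)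
    - inner ℝ (mlieBracket I Y Z x) (X x)

instance instFiniteDimensionalTangentSpace {E : Type*} [NormedAddCommGroup E] [NormedSpace ℝ E]
    [FiniteDimensional ℝ E]
    {H : Type*} [TopologicalSpace H] (I : ModelWithCorners ℝ E H)
    {M : Type*} [TopologicalSpace M] [ChartedSpace H M] (x : M) :
    FiniteDimensional ℝ (TangentSpace I x) :=
  inferInstanceAs (FiniteDimensional ℝ E)

variable {E : Type*} [NormedAddCommGroup E] [NormedSpace ℝ E]
  {H : Type*} [TopologicalSpace H] (I : ModelWithCorners ℝ E H)
  {M : Type*} [TopologicalSpace M] [ChartedSpace H M]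
  [IsManifold I ∞ M] [RiemannianBundle (fun x : M ↦ TangentSpace I x)]
  [IsContMDiffRiemannianBundle I ∞ E (fun x : M ↦ TangentSpace I x)]

theorem mdiffAt_inner {X Y : Π x : M, TangentSpace I x} {x : M} (hX : MDiffAt (T% X) x)
    (hY : MDiffAt (T% Y) x) : MDiffAt (fun y ↦ inner ℝ (X y) (Y y)) x :=
  haveI : IsContMDiffRiemannianBundle I 1 E (fun x : M ↦ TangentSpace I x) := inferInstance
  MDifferentiableAt.inner_bundle (b := fun y ↦ y) hX hY

variable [FiniteDimensional ℝ E]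

theorem koszul_tensorial_left {Y Z : Π x : M, TangentSpace I x} {x : M}
    (hY : MDiffAt (T% Y) x) (hZ : MDiffAt (T% Z) x) :
    TensorialAt I E (koszul I · Y Z x) x where
  smul {f X} hf hX := by
    have h1 := mvfderiv_fun_mul hf (mdiffAt_inner I hX hZ)
    have h2 := mvfderiv_fun_mul hf (mdiffAt_inner I hX hY)
    have h3 := real_inner_smul_right (mlieBracket I Y Z x) (X x) (f x)
    simp [koszul, mlieBracket_smul_left hf hX, inner_smul_left, inner_add_left, h1, h2, h3]
    ring
  add {X X'} hX hX' := by
    have h1 := mvfderiv_fun_add (mdiffAt_inner I hX hZ) (mdiffAt_inner I hX' hZ)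
    have h2 := mvfderiv_fun_add (mdiffAt_inner I hX hY) (mdiffAt_inner I hX' hY)
    have h3 := inner_add_right (𝕜 := ℝ) (mlieBracket I Y Z x) (X x) (X' x)
    simp [koszul, mlieBracket_add_left hX hX', inner_add_left, h1, h2, h3]
    ring

theorem koszul_tensorial_right {X Y : Π x : M, TangentSpace I x} {x : M}
    (hX : MDiffAt (T% X) x) (hY : MDiffAt (T% Y) x) :
    TensorialAt I E (koszul I X Y · x) x where
  smul {f Z} hf hZ := by
    have h1 := mvfderiv_fun_mul hf (mdiffAt_inner I hY hZ)
    have h2 := mvfderiv_fun_mul hf (mdiffAt_inner I hX hZ)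
    have h3 (v : TangentSpace I x) := real_inner_smul_right v (Z x) (f x)
    have h4 (y : M) (v : TangentSpace I y) := real_inner_smul_right v (Z y) (f y)
    have h5 := real_inner_comm (X x) (Z x)
    have h6 := real_inner_comm (Y x) (Z x)
    simp [koszul, mlieBracket_smul_right hf hZ, inner_smul_left, inner_add_left, h1, h2, h3, h4,
      h5, h6]
    ring
  add {Z Z'} hZ hZ' := by
    have h1 := mvfderiv_fun_add (mdiffAt_inner I hX hZ) (mdiffAt_inner I hX hZ')
    have h2 := mvfderiv_fun_add (mdiffAt_inner I hY hZ) (mdiffAt_inner I hY hZ')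
    have h4 (y : M) (v : TangentSpace I y) := inner_add_right (𝕜 := ℝ) v (Z y) (Z' y)
    simp [koszul, mlieBracket_add_right hZ hZ', inner_add_left, h1, h2, h4]
    ring

open Classical in
/-- The bilinear form `(X, Z) ↦ 2 ⟨∇_X Y, Z⟩` at `x`, given by the Koszul formula (and the junk
value `0` if `Y` is not differentiable at `x`). -/
def koszulForm (Y : Π x : M, TangentSpace I x) (x : M) :
    TangentSpace I x →L[ℝ] TangentSpace I x →L[ℝ] ℝ :=
  if hY : MDiffAt (T% Y) x then
    TensorialAt.mkHom₂ (F := E) (F' := E) (I := I) (fun X Z ↦ koszul I X Y Z x) x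
      (fun _ hZ ↦ koszul_tensorial_left I hY hZ) (fun _ hX ↦ koszul_tensorial_right I hX hY)
  else 0

theorem koszulForm_apply {X Y Z : Π x : M, TangentSpace I x} {x : M} (hX : MDiffAt (T% X) x)
    (hY : MDiffAt (T% Y) x) (hZ : MDiffAt (T% Z) x) :
    koszulForm I Y x (X x) (Z x) = koszul I X Y Z x := by
  rw [koszulForm, dif_pos hY]
  exact TensorialAt.mkHom₂_apply _ _ hX hZ

/-- The operator `Y ↦ ∇Y` determined by the Koszul formula. -/
def leviCivitaFun (Y : Π x : M, TangentSpace I x) (x : M) :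
    TangentSpace I x →L[ℝ] TangentSpace I x :=
  LinearMap.toContinuousLinearMap
    { toFun := fun v ↦ (1 / 2 : ℝ) • (InnerProductSpace.toDual ℝ (TangentSpace I x)).symm
        (koszulForm I Y x v)
      map_add' := fun v w ↦ by simp 
      map_smul' := fun c v ↦ by simp [smul_comm c] }

theorem inner_leviCivitaFun (Y : Π x : M, TangentSpace I x) (x : M) (v w : TangentSpace I x) :
    inner ℝ (leviCivitaFun I Y x v) w = (1 / 2) * koszulForm I Y x v w := by
  simp [leviCivitaFun, inner_smul_left]

theorem koszul_add_mid {X Y Y' Z : Π x : M, TangentSpace I x} {x : M} (hX : MDiffAt (T% X) x)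
    (hY : MDiffAt (T% Y) x) (hY' : MDiffAt (T% Y') x) (hZ : MDiffAt (T% Z) x) :
    koszul I X (Y + Y') Z x = koszul I X Y Z x + koszul I X Y' Z x := by
  have h1 := mvfderiv_fun_add (mdiffAt_inner I hX hY) (mdiffAt_inner I hX hY')
  have h2 := mvfderiv_fun_add (mdiffAt_inner I hY hZ) (mdiffAt_inner I hY' hZ)
  have h4 (y : M) (v : TangentSpace I y) := inner_add_right (𝕜 := ℝ) v (Y y) (Y' y)
  simp [koszul, mlieBracket_add_right hY hY', mlieBracket_add_left hY hY', inner_add_left, h1, h2,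
    h4]
  ring

theorem koszul_smul_mid {X Y Z : Π x : M, TangentSpace I x} {f : M → ℝ} {x : M}
    (hX : MDiffAt (T% X) x) (hf : MDiffAt f x) (hY : MDiffAt (T% Y) x) (hZ : MDiffAt (T% Z) x) :
    koszul I X (f • Y) Z x = f x * koszul I X Y Z x + 2 * (d% f x (X x) * inner ℝ (Y x) (Z x)) := by
  have h1 := mvfderiv_fun_mul hf (mdiffAt_inner I hX hY)
  have h2 := mvfderiv_fun_mul hf (mdiffAt_inner I hY hZ)
  have h4 (y : M) (v : TangentSpace I y) := real_inner_smul_right v (Y y) (f y)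
  have h5 := real_inner_comm (X x) (Y x)
  simp [koszul, mlieBracket_smul_right hf hY, mlieBracket_smul_left hf hY, inner_smul_left,
    inner_add_left, h1, h2, h4, h5]
  ring

/-- The Levi-Civita connection of a smooth Riemannian manifold: `∇_X Y` is the vector field
determined by the Koszul formula. -/
def leviCivita : CovariantDerivative I E (TangentSpace I : M → Type _) where
  toFun := leviCivitaFun I
  isCovariantDerivativeOnUniv :=
    { add := by
        intro Y Y' x hY hY' _
        ext v
        refine ext_inner_right ℝ fun w ↦ ?_
        have hv := mdifferentiableAt_extend I E v
        have hw := mdifferentiableAt_extend I E w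
        have h := koszul_add_mid I hv hY hY' hw
        rw [← koszulForm_apply I hv (mdifferentiableAt_add_section hY hY') hw,
          ← koszulForm_apply I hv hY hw,
          ← koszulForm_apply I hv hY' hw] at h
        simp only [extend_apply_self] at h
        rw [add_apply, inner_add_left]
        simp only [inner_leviCivitaFun]
        rw [h]
        ring
      leibniz := by
        intro Y f x hY hf _
        ext v
        refine ext_inner_right ℝ fun w ↦ ?_
        have hv := mdifferentiableAt_extend I E v
        have hw := mdifferentiableAt_extend I E w
        have h := koszul_smul_mid I hv hf hY hw
        rw [← koszulForm_apply I hv (hf.smul_section hY) hw,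
          ← koszulForm_apply I hv hY hw] at h
        simp only [extend_apply_self] at h
        rw [add_apply, inner_add_left, smul_apply,
          real_inner_smul_left, ContinuousLinearMap.smulRight_apply, real_inner_smul_left]
        simp only [inner_leviCivitaFun]
        rw [h]
        ring }

theorem leviCivita_metric {X Y Z : Π x : M, TangentSpace I x} {x : M} (hX : MDiffAt (T% X) x)
    (hY : MDiffAt (T% Y) x) (hZ : MDiffAt (T% Z) x) :
    d% (fun y ↦ inner ℝ (Y y) (Z y)) x (X x) =
      inner ℝ (leviCivita I Y x (X x)) (Z x) + inner ℝ (Y x) (leviCivita I Z x (X x)) := by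
  have h1 := koszulForm_apply I hX hY hZ
  have h2 := koszulForm_apply I hX hZ hY
  have h3 := inner_leviCivitaFun I Y x (X x) (Z x)
  have h4 := inner_leviCivitaFun I Z x (X x) (Y x)
  rw [← real_inner_comm] at h4
  rw [h1] at h3
  rw [h2] at h4
  change _ = inner ℝ (leviCivitaFun I Y x (X x)) (Z x) + inner ℝ (Y x) (leviCivitaFun I Z x (X x))
  rw [h3, h4]
  have h5 := mlieBracket_swap_apply (I := I) (V := Y) (W := Z) (x := x)
  have h6 : (fun y ↦ inner ℝ (Z y) (Y y)) = (fun y ↦ inner ℝ (Y y) (Z y)) := by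
    ext y; exact real_inner_comm _ _
  simp only [koszul, h5, h6, inner_neg_left]
  ring

theorem leviCivita_torsion :
    (leviCivita I : CovariantDerivative I E (TangentSpace I : M → Type _)).torsion = 0 := by
  rw [CovariantDerivative.torsion_eq_zero_iff]
  intro X Y x hX hY
  refine ext_inner_right ℝ fun w ↦ ?_
  have hw := mdifferentiableAt_extend I E w
  have h1 := koszulForm_apply I hX hY hw
  have h2 := koszulForm_apply I hY hX hw
  have h3 := inner_leviCivitaFun I Y x (X x) w
  have h4 := inner_leviCivitaFun I X x (Y x) w
  simp only [extend_apply_self] at h1 h2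
  rw [h1] at h3
  rw [h2] at h4
  change inner ℝ (leviCivitaFun I Y x (X x) - leviCivitaFun I X x (Y x)) w = _
  rw [inner_sub_left, h3, h4]
  have h5 := mlieBracket_swap_apply (I := I) (V := X) (W := Y) (x := x)
  have h6 : (fun y ↦ inner ℝ (X y) (Y y)) = (fun y ↦ inner ℝ (Y y) (X y)) := by
    ext y; exact real_inner_comm _ _
  simp only [koszul, h5, h6, inner_neg_left, extend_apply_self]
  ring

end LeviCivita

/-! ### Coordinate frames and Christoffel symbols -/

section Coordinates

variable {d : ℕ} {M : Type*} [TopologicalSpace M] [ChartedSpace (EuclideanSpace ℝ (Fin d)) M]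

/-- The coordinate vector field `∂ᵢ` of the chart `e`, i.e. the pullback under `e` of the `i`-th
standard constant vector field of `ℝᵈ` (only meaningful on `e.source`). -/
def coordField (e : OpenPartialHomeomorph M (EuclideanSpace ℝ (Fin d))) (i : Fin d) :
    Π x : M, TangentSpace (𝓡 d) x :=
  mpullback (𝓡 d) (𝓡 d) e (fun _ ↦ (EuclideanSpace.single i 1 : EuclideanSpace ℝ (Fin d)))

variable [IsManifold (𝓡 d) ∞ M] [RiemannianBundle (fun x : M ↦ TangentSpace (𝓡 d) x)]

/-- The matrix `gᵢⱼ = g(∂ᵢ, ∂ⱼ)`. -/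
def metricMatrix (e : OpenPartialHomeomorph M (EuclideanSpace ℝ (Fin d))) (x : M) :
    Matrix (Fin d) (Fin d) ℝ :=
  Matrix.of fun i j ↦ inner ℝ (coordField e i x) (coordField e j x)

/-- The inverse matrix `gⁱʲ`. -/
def metricInv (e : OpenPartialHomeomorph M (EuclideanSpace ℝ (Fin d))) (x : M) :
    Matrix (Fin d) (Fin d) ℝ :=
  (metricMatrix e x)⁻¹

/-- The vector field `dxʲ = gⁱʲ ∂ᵢ` (cotangent and tangent vectors are identified by the
metric). -/
def coordDual (e : OpenPartialHomeomorph M (EuclideanSpace ℝ (Fin d))) (j : Fin d) (x : M) :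
    TangentSpace (𝓡 d) x :=
  ∑ i, metricInv e x i j • coordField e i x

variable [IsContMDiffRiemannianBundle (𝓡 d) ∞ (EuclideanSpace ℝ (Fin d))
    (fun x : M ↦ TangentSpace (𝓡 d) x)]

/-- The Christoffel symbols `Γᵢⱼᵏ = dxᵏ(∇_{∂ᵢ} ∂ⱼ)` of the Levi-Civita connection, so that
`∇_{∂ᵢ} ∂ⱼ = Γᵢⱼᵏ ∂ₖ`. -/
def christoffel (e : OpenPartialHomeomorph M (EuclideanSpace ℝ (Fin d))) (i j k : Fin d) (x : M) :
    ℝ :=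
  let v : EuclideanSpace ℝ (Fin d) :=
    mfderiv (𝓡 d) (𝓡 d) e x (leviCivita (𝓡 d) (coordField e j) x (coordField e i x))
  v k

end Coordinates

/-! ### Connections on complex vector bundles and Dirac bundles -/

section DiracBundle

variable {d : ℕ} {M : Type*} [TopologicalSpace M] [ChartedSpace (EuclideanSpace ℝ (Fin d)) M]
  [IsManifold (𝓡 d) ∞ M]
  (F : Type*) [NormedAddCommGroup F] [NormedSpace ℂ F]
  {E : M → Type*} [TopologicalSpace (TotalSpace F E)]
  [∀ x, AddCommGroup (E x)] [∀ x, Module ℂ (E x)] [∀ x, TopologicalSpace (E x)]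
  [∀ x, IsTopologicalAddGroup (E x)] [∀ x, ContinuousSMul ℂ (E x)]
  [FiberBundle F E] [VectorBundle ℂ F E]

variable (d)

/-- Smooth sections of `E`. -/
def IsSmoothSection (σ : Π x : M, E x) : Prop :=
  ContMDiff (𝓡 d) ((𝓡 d).prod 𝓘(ℝ, F)) ∞ (fun x ↦ TotalSpace.mk' F x (σ x))

/-- Smooth sections of `End(E)`, the bundle of complex-linear endomorphisms of `E`; smoothness is
expressed in the ambient bundle of real-linear endomorphisms. -/
def IsSmoothEnd (A : Π x : M, E x →L[ℂ] E x) : Prop :=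
  ContMDiff (𝓡 d) ((𝓡 d).prod 𝓘(ℝ, F →L[ℝ] F)) ∞
    (fun x ↦ TotalSpace.mk' (F →L[ℝ] F) (E := fun x ↦ E x →L[ℝ] E x) x
      ((A x).restrictScalars ℝ))

variable {d}

/-- A smooth connection on the complex vector bundle `E`; `nab σ x v` is `(∇_v σ)(x)`. -/
structure IsSmoothConnection
    (nab : (Π x : M, E x) → Π x : M, TangentSpace (𝓡 d) x →L[ℝ] E x) : Prop where
  isCovariantDerivative : IsCovariantDerivativeOn F nab Set.univ
  complex_leibniz : ∀ {σ : Π x : M, E x} {f : M → ℂ} {x : M},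
    MDifferentiableAt (𝓡 d) ((𝓡 d).prod 𝓘(ℝ, F)) (fun y ↦ TotalSpace.mk' F y (σ y)) x →
    MDifferentiableAt (𝓡 d) 𝓘(ℝ, ℂ) f x → ∀ v : TangentSpace (𝓡 d) x,
      nab (fun y ↦ f y • σ y) x v =
        f x • nab σ x v + (mvfderiv (𝓡 d) f x v) • σ x
  contMDiff : ContMDiffCovariantDerivativeOn F ∞ nab Set.univ

/-- The curvature operator `R_{XY} = [∇_X, ∇_Y] - ∇_{[X, Y]}` acting on sections. -/
def curvature (nab : (Π x : M, E x) → Π x : M, TangentSpace (𝓡 d) x →L[ℝ] E x)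
    (X Y : Π x : M, TangentSpace (𝓡 d) x) (σ : Π x : M, E x) (x : M) : E x :=
  nab (fun y ↦ nab σ y (Y y)) x (X x) - nab (fun y ↦ nab σ y (X y)) x (Y x)
    - nab σ x (mlieBracket (𝓡 d) X Y x)

/-- The connection `(∇̄_v A)(σ) = ∇_v(A σ) - A(∇_v σ)` on `End(E)` induced by a connection on
`E`, applied to the section `σ` at `x`. -/
def endConnection (nab : (Π x : M, E x) → Π x : M, TangentSpace (𝓡 d) x →L[ℝ] E x)
    (A : Π x : M, E x →L[ℂ] E x) (x : M) (v : TangentSpace (𝓡 d) x) (σ : Π x : M, E x) : E x :=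
  nab (fun y ↦ A y (σ y)) x v - A x (nab σ x v)

variable [RiemannianBundle (fun x : M ↦ TangentSpace (𝓡 d) x)]

/-- A Clifford module structure on `E`, given by its restriction to tangent vectors: a smooth
bundle map `γ : TM → End(E)` with `γ(X)γ(Y) + γ(Y)γ(X) = -2 g(X, Y)`. By the universal property of
the Clifford algebra this is the same as a unital algebra morphism `Cl(TM) → End(E)`. -/
structure IsCliffordAction (γ : Π x : M, TangentSpace (𝓡 d) x →ₗ[ℝ] (E x →L[ℂ] E x)) : Prop where
  clifford : ∀ (x : M) (X Y : TangentSpace (𝓡 d) x) (w : E x),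
    γ x X (γ x Y w) + γ x Y (γ x X w) = (-(2 * inner ℝ X Y) : ℝ) • w
  smooth : ∃ Γ : Π x : M, TangentSpace (𝓡 d) x →L[ℝ] E x →L[ℝ] E x,
    ContMDiff (𝓡 d) ((𝓡 d).prod 𝓘(ℝ, EuclideanSpace ℝ (Fin d) →L[ℝ] F →L[ℝ] F)) ∞
      (fun x ↦ TotalSpace.mk' (EuclideanSpace ℝ (Fin d) →L[ℝ] F →L[ℝ] F)
        (E := fun x ↦ TangentSpace (𝓡 d) x →L[ℝ] E x →L[ℝ] E x) x (Γ x)) ∧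
    ∀ (x : M) (X : TangentSpace (𝓡 d) x) (w : E x), Γ x X w = γ x X w

variable [IsContMDiffRiemannianBundle (𝓡 d) ∞ (EuclideanSpace ℝ (Fin d))
    (fun x : M ↦ TangentSpace (𝓡 d) x)]

/-- `(E, γ, nab)` is a Dirac bundle: `γ` is a Clifford module structure on `E` and `nab` is a
connection compatible with `γ`, i.e. `nab_v(γ(Y)σ) = γ(∇_v Y)σ + γ(Y)(nab_v σ)` with `∇` the
Levi-Civita connection. -/
structure IsDiracBundle (γ : Π x : M, TangentSpace (𝓡 d) x →ₗ[ℝ] (E x →L[ℂ] E x))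
    (nab : (Π x : M, E x) → Π x : M, TangentSpace (𝓡 d) x →L[ℝ] E x) : Prop where
  isCliffordAction : IsCliffordAction F γ
  isSmoothConnection : IsSmoothConnection F nab
  compatible : ∀ {Y : Π x : M, TangentSpace (𝓡 d) x} {σ : Π x : M, E x} {x : M},
    MDifferentiableAt (𝓡 d) ((𝓡 d).prod 𝓘(ℝ, EuclideanSpace ℝ (Fin d)))
      (fun y ↦ TotalSpace.mk' (EuclideanSpace ℝ (Fin d)) (E := TangentSpace (𝓡 d)) y (Y y)) x →
    MDifferentiableAt (𝓡 d) ((𝓡 d).prod 𝓘(ℝ, F)) (fun y ↦ TotalSpace.mk' F y (σ y)) x →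
    ∀ v : TangentSpace (𝓡 d) x,
      nab (fun y ↦ γ y (Y y) (σ y)) x v =
        γ x (leviCivita (𝓡 d) Y x v) (σ x) + γ x (Y x) (nab σ x v)

end DiracBundle

/-! ### Dirac type operators, connection Laplacian and potential -/

section Operators

variable {d : ℕ} {M : Type*} [TopologicalSpace M] [ChartedSpace (EuclideanSpace ℝ (Fin d)) M]
  [IsManifold (𝓡 d) ∞ M] [RiemannianBundle (fun x : M ↦ TangentSpace (𝓡 d) x)]
  {E : M → Type*}
  [∀ x, AddCommGroup (E x)] [∀ x, Module ℂ (E x)] [∀ x, TopologicalSpace (E x)]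
  [∀ x, IsTopologicalAddGroup (E x)] [∀ x, ContinuousSMul ℂ (E x)]

/-- The Dirac type operator `D = γ nab + ψ = ∑ₖ γ(eₖ) nab_{eₖ} + ψ`, where `(eₖ)` is an orthonormal
basis of the tangent space at the point. -/
def diracOperator (γ : Π x : M, TangentSpace (𝓡 d) x →ₗ[ℝ] (E x →L[ℂ] E x))
    (nab : (Π x : M, E x) → Π x : M, TangentSpace (𝓡 d) x →L[ℝ] E x)
    (ψ : Π x : M, E x →L[ℂ] E x) (σ : Π x : M, E x) (x : M) : E x :=
  ∑ k, γ x (stdOrthonormalBasis ℝ (TangentSpace (𝓡 d) x) k)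
    (nab σ x (stdOrthonormalBasis ℝ (TangentSpace (𝓡 d) x) k)) + ψ x (σ x)

/-- `L(X) = (γ(X)ψ + ψγ(X)) / 2`. -/
def potentialForm (γ : Π x : M, TangentSpace (𝓡 d) x →ₗ[ℝ] (E x →L[ℂ] E x))
    (ψ : Π x : M, E x →L[ℂ] E x) (x : M) (X : TangentSpace (𝓡 d) x) : E x →L[ℂ] E x :=
  (1 / 2 : ℂ) • (γ x X ∘L ψ x + ψ x ∘L γ x X)

/-- The connection `∇_ψ = nab - L`. -/
def shiftedConnection (γ : Π x : M, TangentSpace (𝓡 d) x →ₗ[ℝ] (E x →L[ℂ] E x))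
    (nab : (Π x : M, E x) → Π x : M, TangentSpace (𝓡 d) x →L[ℝ] E x)
    (ψ : Π x : M, E x →L[ℂ] E x) (σ : Π x : M, E x) (x : M) : TangentSpace (𝓡 d) x →L[ℝ] E x :=
  nab σ x - LinearMap.toContinuousLinearMap
    { toFun := fun X ↦ potentialForm γ ψ x X (σ x)
      map_add' := fun X Y ↦ by
        simp only [potentialForm, map_add, smul_apply,
          add_apply, ContinuousLinearMap.comp_apply, smul_add]
        abel
      map_smul' := fun c X ↦ by
        simp only [potentialForm, map_smul, smul_apply,
          add_apply, ContinuousLinearMap.comp_apply, smul_add,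
          RingHom.id_apply, ContinuousLinearMap.map_smul_of_tower]
        simp only [smul_comm c] }

/-- The value at `x` of the right-hand side
`½ γⁱγʲRᵢⱼ + ½ [γⁱ, ∇̄ᵢψ] + LⁱLᵢ + ψ²` in the chart `e`, applied to the section `σ`. Here
`Uᵢ = U(∂ᵢ)` and `Uⁱ = U(dxⁱ)`. -/
def weitzenbockTerm (e : OpenPartialHomeomorph M (EuclideanSpace ℝ (Fin d)))
    (γ : Π x : M, TangentSpace (𝓡 d) x →ₗ[ℝ] (E x →L[ℂ] E x))
    (nab : (Π x : M, E x) → Π x : M, TangentSpace (𝓡 d) x →L[ℝ] E x)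
    (ψ : Π x : M, E x →L[ℂ] E x) (σ : Π x : M, E x) (x : M) : E x :=
  (1 / 2 : ℝ) • ∑ i, ∑ j, γ x (coordDual e i x) (γ x (coordDual e j x)
      (curvature nab (coordField e i) (coordField e j) σ x))
    + (1 / 2 : ℝ) • ∑ i, (γ x (coordDual e i x) (endConnection nab ψ x (coordField e i x) σ)
      - endConnection nab ψ x (coordField e i x) (fun y ↦ γ y (coordDual e i y) (σ y)))
    + ∑ i, potentialForm γ ψ x (coordDual e i x) (potentialForm γ ψ x (coordField e i x) (σ x))
    + ψ x (ψ x (σ x))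

variable [IsContMDiffRiemannianBundle (𝓡 d) ∞ (EuclideanSpace ℝ (Fin d))
    (fun x : M ↦ TangentSpace (𝓡 d) x)]

/-- The coordinate expression `-gⁱʲ(∇ᵢ∇ⱼ - Γᵢⱼᵏ∇ₖ)σ` of the connection Laplacian in the
chart `e`, at `x ∈ e.source`. -/
def laplacianInChart (e : OpenPartialHomeomorph M (EuclideanSpace ℝ (Fin d)))
    (nab : (Π x : M, E x) → Π x : M, TangentSpace (𝓡 d) x →L[ℝ] E x) (σ : Π x : M, E x) (x : M) :
    E x :=
  -∑ i, ∑ j, metricInv e x i j •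
    (nab (fun y ↦ nab σ y (coordField e j y)) x (coordField e i x)
      - ∑ k, christoffel e i j k x • nab σ x (coordField e k x))

/-- The connection Laplacian of `nab`: at each point, its coordinate expression in the preferred
chart there (the expression does not depend on the chart). -/
def connectionLaplacian
    (nab : (Π x : M, E x) → Π x : M, TangentSpace (𝓡 d) x →L[ℝ] E x) (σ : Π x : M, E x) (x : M) :
    E x :=
  laplacianInChart (chartAt (EuclideanSpace ℝ (Fin d)) x) nab σ x

end Operators

end

/-! Fix a chart with coordinate frame `∂ᵢ` and metric-dual frame `dxⁱ`. There `D = γʲ∇̃ⱼ + ψ`, and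
squaring produces three kinds of terms.

Second order: since `γ` is parallel, `γⁱ∇̃ᵢ(γʲ∇̃ⱼσ) = γⁱγʲHᵢⱼ`, where `H(X,Y) = ∇̃_X∇̃_Yσ - ∇̃_{∇_X
Y}σ` is the tensorial second covariant derivative (`nab_sum_coordDual`). The Clifford relation turns
the symmetric part of `H` into minus its trace, which is the Laplacian of `∇̃`. As `∇` has no
torsion, the antisymmetric part is half the curvature (`sum_sum_coordDual`, `curvature_eq_sub`).

First order: `γⁱ∇̃ᵢ(ψσ) + ψγⁱ∇̃ᵢσ = γⁱ(∇̄ᵢψ)σ + 2Lⁱ∇̃ᵢσ`. Passing from `∇̃` to `∇̃ - L` adds exactly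
`2Lⁱ∇̃ᵢσ` to the Laplacian, together with `(div L)σ - LⁱLᵢσ`
(`shiftedConnection_shiftedConnection`). This is why `L` has the form it has.

Zeroth order: as `div L = ½(γⁱ∇̄ᵢψ + (∇̄ᵢψ)γⁱ)`, what remains of `γⁱ∇̄ᵢψ` is half a commutator, and
`LⁱLᵢ` and `ψ²` are left over. The pieces meet in `diracOperator_diracOperator`.

The frame enters only through traces of bilinear maps, which are the same for every pair of dual
frames (`sum_orthonormalBasis_eq_sum_coordDual_coordField`). Hence the Laplacian does not depend on
the chart, and neither does the zeroth order term, being `D²` minus the Laplacian. That term is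
linear over smooth functions and over `ℂ`, so it is a field of endomorphisms (`exists_potential`),
smooth because it preserves smooth local sections. Coordinate frames live only on chart domains, so
the calculus is done for sections smooth on an open set. -/

noncomputable section

open Topology Module

/-! ### Sections that are smooth on an open set -/

section SectionCalculus

variable {d : ℕ} {M : Type*} [TopologicalSpace M] [ChartedSpace (EuclideanSpace ℝ (Fin d)) M]
  (F : Type*) [NormedAddCommGroup F] [NormedSpace ℝ F]
  {V : M → Type*} [TopologicalSpace (TotalSpace F V)]
  [∀ x, TopologicalSpace (V x)] [FiberBundle F V]

variable (d) in
/-- The section `σ` is smooth on `U`. -/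
def IsSmoothSectionOn (σ : Π x : M, V x) (U : Set M) : Prop :=
  ContMDiffOn (𝓡 d) ((𝓡 d).prod 𝓘(ℝ, F)) ∞ (fun x ↦ TotalSpace.mk' F x (σ x)) U

variable {F} {σ τ : Π x : M, V x} {U W : Set M} {x : M}

namespace IsSmoothSectionOn

theorem mono (h : IsSmoothSectionOn d F σ U) (hW : W ⊆ U) : IsSmoothSectionOn d F σ W :=
  ContMDiffOn.mono h hW

theorem congr (h : IsSmoothSectionOn d F σ U) (hτ : ∀ x ∈ U, τ x = σ x) :
    IsSmoothSectionOn d F τ U :=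
  ContMDiffOn.congr h fun x hx ↦ by rw [hτ x hx]

theorem contMDiffAt (h : IsSmoothSectionOn d F σ U) (hU : IsOpen U) (hx : x ∈ U) :
    ContMDiffAt (𝓡 d) ((𝓡 d).prod 𝓘(ℝ, F)) ∞ (fun x ↦ TotalSpace.mk' F x (σ x)) x :=
  ContMDiffOn.contMDiffAt h (hU.mem_nhds hx)

theorem mdifferentiableAt (h : IsSmoothSectionOn d F σ U) (hU : IsOpen U) (hx : x ∈ U) :
    MDifferentiableAt (𝓡 d) ((𝓡 d).prod 𝓘(ℝ, F)) (fun x ↦ TotalSpace.mk' F x (σ x)) x :=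
  (h.contMDiffAt hU hx).mdifferentiableAt (by simp)

theorem of_forall_mem_nhds (h : ∀ x ∈ U, ∃ W ∈ 𝓝 x, IsSmoothSectionOn d F σ W) :
    IsSmoothSectionOn d F σ U := by
  intro x hx
  obtain ⟨W, hW, hσ⟩ := h x hx
  exact (ContMDiffOn.contMDiffAt hσ hW).contMDiffWithinAt

variable [∀ x, AddCommGroup (V x)] [∀ x, Module ℝ (V x)] [VectorBundle ℝ F V]

theorem add (hσ : IsSmoothSectionOn d F σ U) (hτ : IsSmoothSectionOn d F τ U) :
    IsSmoothSectionOn d F (fun x ↦ σ x + τ x) U :=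
  ContMDiffOn.add_section hσ hτ

theorem sub (hσ : IsSmoothSectionOn d F σ U) (hτ : IsSmoothSectionOn d F τ U) :
    IsSmoothSectionOn d F (fun x ↦ σ x - τ x) U :=
  ContMDiffOn.sub_section hσ hτ

theorem smul {f : M → ℝ} (hf : ContMDiffOn (𝓡 d) 𝓘(ℝ) ∞ f U) (hσ : IsSmoothSectionOn d F σ U) :
    IsSmoothSectionOn d F (fun x ↦ f x • σ x) U :=
  ContMDiffOn.smul_section hf hσ

theorem const_smul (c : ℝ) (hσ : IsSmoothSectionOn d F σ U) :
    IsSmoothSectionOn d F (fun x ↦ c • σ x) U :=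
  hσ.smul contMDiffOn_const

theorem sum {ι : Type*} {s : Finset ι} {t : ι → Π x : M, V x}
    (h : ∀ i ∈ s, IsSmoothSectionOn d F (t i) U) :
    IsSmoothSectionOn d F (fun x ↦ ∑ i ∈ s, t i x) U :=
  ContMDiffOn.sum_section h

/-- A locally smooth section agrees near any given point with a globally smooth one. -/
theorem exists_global [IsManifold (𝓡 d) ∞ M] [T2Space M] (hσ : IsSmoothSectionOn d F σ U)
    (hU : IsOpen U) (hx : x ∈ U) :
    ∃ τ : Π x : M, V x, IsSmoothSectionOn d F τ Set.univ ∧ ∀ᶠ y in 𝓝 x, τ y = σ y := by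
  -- A bump function whose closed support lies in `U` makes `f • σ` smooth everywhere, whatever `σ`
  -- does outside `U`. The Hausdorff hypothesis provides such functions.
  obtain ⟨f, -, hf⟩ := (SmoothBumpFunction.nhds_basis_tsupport (I := 𝓡 d) x).mem_iff.1
    (hU.mem_nhds hx)
  refine ⟨fun y ↦ f y • σ y, ?_, ?_⟩
  · exact (ContMDiffOn.smul_section_of_tsupport f.contMDiff.contMDiffOn hU hf hσ).contMDiffOn
  · filter_upwards [f.eventuallyEq_one] with y hy
    simp [hy]

end IsSmoothSectionOn

theorem isSmoothSectionOn_extend [∀ x, AddCommGroup (V x)] [∀ x, Module ℝ (V x)]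
    [VectorBundle ℝ F V] [ContMDiffVectorBundle ∞ F V (𝓡 d)]
    (v : V x) :
    IsSmoothSectionOn d F (extend F v) (trivializationAt F V x).baseSet := by
  set t := trivializationAt F V x
  refine (t.contMDiffOn_section_baseSet_iff).2 ?_
  exact (contMDiffOn_const (c := (t ⟨x, v⟩).2)).congr (fun y hy ↦ by simp [extend, t, hy])

theorem isSmoothSectionOn_symm [∀ x, AddCommGroup (V x)] [∀ x, Module ℝ (V x)]
    [VectorBundle ℝ F V] [ContMDiffVectorBundle ∞ F V (𝓡 d)]
    (x : M) (w : F) :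
    IsSmoothSectionOn d F (fun y ↦ (trivializationAt F V x).symm y w)
      (trivializationAt F V x).baseSet := by
  refine ((trivializationAt F V x).contMDiffOn_section_baseSet_iff).2 ?_
  exact (contMDiffOn_const (c := w)).congr (fun y hy ↦ by simp [hy])

end SectionCalculus

/-! ### Smooth fields of linear maps -/

section HomCalculus

variable {d : ℕ} {M : Type*} [TopologicalSpace M] [ChartedSpace (EuclideanSpace ℝ (Fin d)) M]
  {F₁ : Type*} [NormedAddCommGroup F₁] [NormedSpace ℝ F₁]
  {V₁ : M → Type*} [TopologicalSpace (TotalSpace F₁ V₁)]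
  [∀ x, AddCommGroup (V₁ x)] [∀ x, Module ℝ (V₁ x)] [∀ x, TopologicalSpace (V₁ x)]
  [FiberBundle F₁ V₁] [VectorBundle ℝ F₁ V₁]
  {F₂ : Type*} [NormedAddCommGroup F₂] [NormedSpace ℝ F₂]
  {V₂ : M → Type*} [TopologicalSpace (TotalSpace F₂ V₂)]
  [∀ x, AddCommGroup (V₂ x)] [∀ x, Module ℝ (V₂ x)] [∀ x, TopologicalSpace (V₂ x)]
  [∀ x, IsTopologicalAddGroup (V₂ x)] [∀ x, ContinuousSMul ℝ (V₂ x)]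
  [FiberBundle F₂ V₂] [VectorBundle ℝ F₂ V₂]
  {A : Π x : M, V₁ x →L[ℝ] V₂ x} {U : Set M}

/-- A basis of `E` identifies `E →L[ℝ] G` with a finite power of `G`, where smoothness is
componentwise. -/
theorem contMDiffAt_clm_of_apply {E G : Type*} [NormedAddCommGroup E] [NormedSpace ℝ E]
    [FiniteDimensional ℝ E] [NormedAddCommGroup G] [NormedSpace ℝ G] {f : M → E →L[ℝ] G} {x : M}
    (h : ∀ v, ContMDiffAt (𝓡 d) 𝓘(ℝ, G) ∞ (fun y ↦ f y v) x) :
    ContMDiffAt (𝓡 d) 𝓘(ℝ, E →L[ℝ] G) ∞ f x := by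
  let n := finrank ℝ E
  have hn : n = finrank ℝ (Fin n → ℝ) := (finrank_fin_fun ℝ).symm
  let e₁ := ContinuousLinearEquiv.ofFinrankEq hn
  let e₂ := (e₁.arrowCongr (1 : G ≃L[ℝ] G)).trans (ContinuousLinearEquiv.piRing (Fin n))
  rw [← Function.id_comp f, ← e₂.symm_comp_self]
  have h2 : ContMDiffAt (𝓡 d) 𝓘(ℝ, Fin n → G) ∞ (e₂ ∘ f) x :=
    contMDiffAt_pi_space.2 fun i ↦ h _
  exact e₂.symm.contDiff.contMDiff.contMDiffAt.comp x h2

theorem IsSmoothSectionOn.clm_apply {s : Π x : M, V₁ x}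
    (hA : IsSmoothSectionOn d (F₁ →L[ℝ] F₂) A U)
    (hs : IsSmoothSectionOn d F₁ s U) : IsSmoothSectionOn d F₂ (fun x ↦ A x (s x)) U :=
  ContMDiffOn.clm_bundle_apply hA hs

/-- A field of linear maps is smooth if it maps smooth local sections to smooth local sections. -/
theorem isSmoothSectionOn_hom [ContMDiffVectorBundle ∞ F₁ V₁ (𝓡 d)]
    [ContMDiffVectorBundle ∞ F₂ V₂ (𝓡 d)] [FiniteDimensional ℝ F₁] (hU : IsOpen U)
    (h : ∀ W ⊆ U, IsOpen W → ∀ s : Π x : M, V₁ x, IsSmoothSectionOn d F₁ s W →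
      IsSmoothSectionOn d F₂ (fun x ↦ A x (s x)) W) :
    IsSmoothSectionOn d (F₁ →L[ℝ] F₂) A U := by
  intro x hx
  refine ContMDiffAt.contMDiffWithinAt ((contMDiffAt_hom_bundle _).2 ⟨contMDiffAt_id, ?_⟩)
  refine contMDiffAt_clm_of_apply fun v ↦ ?_
  set t₁ := trivializationAt F₁ V₁ x
  set t₂ := trivializationAt F₂ V₂ x
  have hx₁ : x ∈ t₁.baseSet := mem_baseSet_trivializationAt' x
  have hx₂ : x ∈ t₂.baseSet := mem_baseSet_trivializationAt' x
  -- The test section has the constant value `v` in the trivialization of `V₁`. Its image, read in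
  -- the trivialization of `V₂`, is the coordinate expression of `A` applied to `v`.
  have hs := h (U ∩ t₁.baseSet) Set.inter_subset_left (hU.inter t₁.open_baseSet) _
    ((isSmoothSectionOn_symm x v).mono Set.inter_subset_right)
  have hs' := (contMDiffAt_section _).1
    (hs.contMDiffAt (hU.inter t₁.open_baseSet) ⟨hx, hx₁⟩)
  refine hs'.congr_of_eventuallyEq ?_
  filter_upwards [t₁.open_baseSet.mem_nhds hx₁, t₂.open_baseSet.mem_nhds hx₂] with y hy₁ hy₂
  simp [ContinuousLinearMap.inCoordinates, t₁, t₂, hy₁,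
    Trivialization.coe_linearMapAt_of_mem _ hy₂]

end HomCalculus

/-! ### Coordinate frames -/

section CoordinateFrame

variable {d : ℕ} {M : Type*} [TopologicalSpace M] [ChartedSpace (EuclideanSpace ℝ (Fin d)) M]
  {e : OpenPartialHomeomorph M (EuclideanSpace ℝ (Fin d))}

theorem mdifferentiable_of_mem_maximalAtlas (he : e ∈ IsManifold.maximalAtlas (𝓡 d) ∞ M) :
    e.MDifferentiable (𝓡 d) (𝓡 d) :=
  ⟨(contMDiffOn_of_mem_maximalAtlas he).mdifferentiableOn (by simp),
    (contMDiffOn_symm_of_mem_maximalAtlas he).mdifferentiableOn (by simp)⟩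

theorem isInvertible_mfderiv_of_mem_maximalAtlas (he : e ∈ IsManifold.maximalAtlas (𝓡 d) ∞ M)
    {x : M} (hx : x ∈ e.source) : (mfderiv (𝓡 d) (𝓡 d) e x).IsInvertible :=
  ⟨(mdifferentiable_of_mem_maximalAtlas he).mfderiv hx, rfl⟩

theorem isSmoothSectionOn_coordField [IsManifold (𝓡 d) ∞ M]
    (he : e ∈ IsManifold.maximalAtlas (𝓡 d) ∞ M) (i : Fin d) :
    IsSmoothSectionOn d (EuclideanSpace ℝ (Fin d)) (coordField e i) e.source := by
  intro x hx
  refine ContMDiffAt.contMDiffWithinAt (ContMDiffAt.mpullback_vectorField_preimage (n := ∞) ?_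
    ((contMDiffOn_of_mem_maximalAtlas he).contMDiffAt (e.open_source.mem_nhds hx))
    (isInvertible_mfderiv_of_mem_maximalAtlas he hx) (by simp))
  exact contMDiffAt_vectorSpace_iff_contDiffAt.2 contDiffAt_const

/-- The `k`-th component of the tangent vector `v` in the chart `e`. -/
def coordComponent (e : OpenPartialHomeomorph M (EuclideanSpace ℝ (Fin d))) (x : M) (k : Fin d)
    (v : TangentSpace (𝓡 d) x) : ℝ :=
  (show EuclideanSpace ℝ (Fin d) from mfderiv (𝓡 d) (𝓡 d) e x v) k

theorem exists_tangentEquiv (he : e ∈ IsManifold.maximalAtlas (𝓡 d) ∞ M) {x : M}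
    (hx : x ∈ e.source) : ∃ A : TangentSpace (𝓡 d) x ≃L[ℝ] EuclideanSpace ℝ (Fin d),
      (∀ v, mfderiv (𝓡 d) (𝓡 d) e x v = A v) ∧
      ∀ i, coordField e i x = A.symm (EuclideanSpace.single i 1) := by
  obtain ⟨A, hA⟩ := isInvertible_mfderiv_of_mem_maximalAtlas he hx
  refine ⟨A, fun v ↦ by rw [← hA]; rfl, fun i ↦ ?_⟩
  change (mfderiv (𝓡 d) (𝓡 d) e x).inverse (EuclideanSpace.single i (1 : ℝ)) = _
  rw [← hA, ContinuousLinearMap.inverse_equiv]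
  rfl

theorem mfderiv_coordField (he : e ∈ IsManifold.maximalAtlas (𝓡 d) ∞ M) {x : M}
    (hx : x ∈ e.source) (i : Fin d) :
    mfderiv (𝓡 d) (𝓡 d) e x (coordField e i x) = EuclideanSpace.single i (1 : ℝ) := by
  obtain ⟨A, hA, hA'⟩ := exists_tangentEquiv he hx
  rw [hA, hA']
  exact A.apply_symm_apply _

theorem sum_coordComponent_smul (he : e ∈ IsManifold.maximalAtlas (𝓡 d) ∞ M) {x : M}
    (hx : x ∈ e.source) (v : TangentSpace (𝓡 d) x) :
    ∑ k, coordComponent e x k v • coordField e k x = v := by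
  obtain ⟨A, hA, hA'⟩ := exists_tangentEquiv he hx
  apply A.injective
  simp only [map_sum, map_smul, hA', A.apply_symm_apply, coordComponent, hA]
  ext j
  simp [Pi.single_apply]

theorem linearIndependent_coordField (he : e ∈ IsManifold.maximalAtlas (𝓡 d) ∞ M) {x : M}
    (hx : x ∈ e.source) : LinearIndependent ℝ (fun i ↦ coordField e i x) := by
  obtain ⟨A, -, hA'⟩ := exists_tangentEquiv he hx
  have h := (EuclideanSpace.basisFun (Fin d) ℝ).toBasis.linearIndependent.map'
    A.symm.toLinearEquiv.toLinearMap (LinearEquiv.ker _)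
  convert! h using 1
  ext1 k
  simp [hA']

theorem mlieBracket_const (z a b : EuclideanSpace ℝ (Fin d)) :
    mlieBracket (𝓡 d) (fun y ↦ (a : TangentSpace (𝓡 d) y)) (fun y ↦ (b : TangentSpace (𝓡 d) y)) z
      = 0 := by
  refine (congrFun mlieBracketWithin_univ z).symm.trans
    ((congrFun mlieBracketWithin_eq_lieBracketWithin z).trans ?_)
  simp [lieBracketWithin]
  rfl

/-- Pullback commutes with the Lie bracket, and constant vector fields commute. -/
theorem mlieBracket_coordField [IsManifold (𝓡 d) ∞ M]
    (he : e ∈ IsManifold.maximalAtlas (𝓡 d) ∞ M) {x : M}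
    (hx : x ∈ e.source) (i j : Fin d) :
    mlieBracket (𝓡 d) (coordField e i) (coordField e j) x = 0 := by
  have h (i : Fin d) : MDifferentiableAt (𝓡 d) (𝓡 d).tangent
      (fun y : EuclideanSpace ℝ (Fin d) ↦ (⟨y, EuclideanSpace.single i (1 : ℝ)⟩ :
        TangentBundle (𝓡 d) (EuclideanSpace ℝ (Fin d)))) (e x) :=
    ContMDiffAt.mdifferentiableAt (n := 1)
      (contMDiffAt_vectorSpace_iff_contDiffAt.2 contDiffAt_const) (by simp)
  have hm : minSmoothness ℝ 2 ≤ (∞ : WithTop ℕ∞) := by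
    rw [minSmoothness_of_isRCLikeNormedField]
    exact WithTop.coe_le_coe.2 (le_top : (2 : ℕ∞) ≤ ⊤)
  have : IsManifold (𝓡 d) (minSmoothness ℝ 2) M := IsManifold.of_le hm
  rw [coordField, coordField, ← mpullback_mlieBracket (n := ∞) (h i) (h j)
    ((contMDiffOn_of_mem_maximalAtlas he).contMDiffAt (e.open_source.mem_nhds hx)) hm]
  exact (congrArg _ (mlieBracket_const (e x) _ _)).trans (map_zero _)

theorem mvfderiv_coordField (he : e ∈ IsManifold.maximalAtlas (𝓡 d) ∞ M) {x : M}
    (hx : x ∈ e.source) {f : M → ℝ} (hf : MDifferentiableAt (𝓡 d) 𝓘(ℝ) f x) (i : Fin d) :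
    mvfderiv (𝓡 d) f x (coordField e i x) =
      fderiv ℝ (f ∘ e.symm) (e x) (EuclideanSpace.single i 1) := by
  have hd := mdifferentiable_of_mem_maximalAtlas he
  have hf' : MDifferentiableAt (𝓡 d) 𝓘(ℝ) (f ∘ e.symm) (e x) := by
    refine MDifferentiableAt.comp (e x) (I' := 𝓡 d) ?_ (hd.mdifferentiableAt_symm (e.map_source hx))
    rwa [e.left_inv hx]
  have h2 : mfderiv (𝓡 d) 𝓘(ℝ) f x =
      (mfderiv (𝓡 d) 𝓘(ℝ) (f ∘ e.symm) (e x)).comp (mfderiv (𝓡 d) (𝓡 d) e x) := by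
    rw [← mfderiv_comp x hf' (hd.mdifferentiableAt hx)]
    refine Filter.EventuallyEq.mfderiv_eq ?_
    filter_upwards [e.open_source.mem_nhds hx] with y hy
    simp [e.left_inv hy]
  have h3 : mfderiv (𝓡 d) 𝓘(ℝ) f x (coordField e i x) =
      mfderiv (𝓡 d) 𝓘(ℝ) (f ∘ e.symm) (e x) (EuclideanSpace.single i (1 : ℝ)) := by
    rw [h2, ← mfderiv_coordField he hx i]
    rfl
  rw [mfderiv_eq_fderiv] at h3
  exact h3


theorem contDiffOn_comp_symm (he : e ∈ IsManifold.maximalAtlas (𝓡 d) ∞ M) {U : Set M} {f : M → ℝ}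
    (hf : ContMDiffOn (𝓡 d) 𝓘(ℝ) ∞ f U) :
    ContDiffOn ℝ ∞ (f ∘ e.symm) (e.target ∩ e.symm ⁻¹' U) :=
  (hf.comp ((contMDiffOn_symm_of_mem_maximalAtlas he).mono Set.inter_subset_left)
    (fun _ hz ↦ hz.2)).contDiffOn

theorem contDiffOn_fderiv_comp_symm (he : e ∈ IsManifold.maximalAtlas (𝓡 d) ∞ M) {U : Set M}
    (hU : IsOpen U) {f : M → ℝ} (hf : ContMDiffOn (𝓡 d) 𝓘(ℝ) ∞ f U) :
    ContDiffOn ℝ ∞ (fderiv ℝ (f ∘ e.symm)) (e.target ∩ e.symm ⁻¹' U) :=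
  (contDiffOn_comp_symm he hf).fderiv_of_isOpen (e.isOpen_inter_preimage_symm hU) (by simp)

theorem contMDiffOn_mvfderiv_coordField (he : e ∈ IsManifold.maximalAtlas (𝓡 d) ∞ M) {U : Set M}
    (hU : IsOpen U) (hUe : U ⊆ e.source) {f : M → ℝ} (hf : ContMDiffOn (𝓡 d) 𝓘(ℝ) ∞ f U)
    (i : Fin d) :
    ContMDiffOn (𝓡 d) 𝓘(ℝ) ∞ (fun y ↦ mvfderiv (𝓡 d) f y (coordField e i y)) U := by
  have h1 := (contDiffOn_fderiv_comp_symm he hU hf).clm_apply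
    (contDiffOn_const (c := EuclideanSpace.single i (1 : ℝ)))
  refine (h1.contMDiffOn.comp ((contMDiffOn_of_mem_maximalAtlas he).mono hUe)
    fun y hy ↦ ⟨e.map_source (hUe hy), by simpa [e.left_inv (hUe hy)] using hy⟩).congr ?_
  intro y hy
  exact mvfderiv_coordField he (hUe hy)
    ((hf.contMDiffAt (hU.mem_nhds hy)).mdifferentiableAt (by simp)) i

/-- Partial derivatives of smooth functions commute. -/
theorem mvfderiv_mvfderiv_coordField_comm (he : e ∈ IsManifold.maximalAtlas (𝓡 d) ∞ M) {U : Set M}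
    (hU : IsOpen U) (hUe : U ⊆ e.source) {f : M → ℝ} (hf : ContMDiffOn (𝓡 d) 𝓘(ℝ) ∞ f U)
    {x : M} (hx : x ∈ U) (i j : Fin d) :
    mvfderiv (𝓡 d) (fun y ↦ mvfderiv (𝓡 d) f y (coordField e i y)) x (coordField e j x) =
      mvfderiv (𝓡 d) (fun y ↦ mvfderiv (𝓡 d) f y (coordField e j y)) x (coordField e i x) := by
  set g := f ∘ e.symm
  have hT : e.target ∩ e.symm ⁻¹' U ∈ 𝓝 (e x) :=
    (e.isOpen_inter_preimage_symm hU).mem_nhds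
      ⟨e.map_source (hUe hx), by simpa [e.left_inv (hUe hx)] using hx⟩
  -- In the chart both sides are values of the second derivative of `g`, so the claim is its
  -- symmetry.
  have key (i j : Fin d) :
      mvfderiv (𝓡 d) (fun y ↦ mvfderiv (𝓡 d) f y (coordField e i y)) x (coordField e j x) =
        fderiv ℝ (fderiv ℝ g) (e x) (EuclideanSpace.single j 1) (EuclideanSpace.single i 1) := by
    rw [mvfderiv_coordField he (hUe hx) (((contMDiffOn_mvfderiv_coordField he hU hUe hf
      i).contMDiffAt (hU.mem_nhds hx)).mdifferentiableAt (by simp))]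
    have h1 : (fun y ↦ mvfderiv (𝓡 d) f y (coordField e i y)) ∘ e.symm =ᶠ[𝓝 (e x)]
        fun z ↦ fderiv ℝ g z (EuclideanSpace.single i 1) := by
      filter_upwards [hT] with z hz
      have := mvfderiv_coordField he (hUe hz.2)
        ((hf.contMDiffAt (hU.mem_nhds hz.2)).mdifferentiableAt (by simp)) i
      rw [e.right_inv hz.1] at this
      exact this
    rw [h1.fderiv_eq, fderiv_clm_apply
      (((contDiffOn_fderiv_comp_symm he hU hf).contDiffAt hT).differentiableAt (by simp))
      (differentiableAt_const _)]
    simp [g]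
  rw [key, key]
  refine ((contDiffOn_comp_symm he hf).contDiffAt hT).isSymmSndFDerivAt ?_ _ _
  rw [minSmoothness_of_isRCLikeNormedField]
  exact WithTop.coe_le_coe.2 (le_top : (2 : ℕ∞) ≤ ⊤)

theorem contMDiffOn_det {ι : Type*} [Fintype ι] [DecidableEq ι] {A : M → Matrix ι ι ℝ} {U : Set M}
    (hA : ∀ i j, ContMDiffOn (𝓡 d) 𝓘(ℝ) ∞ (fun x ↦ A x i j) U) :
    ContMDiffOn (𝓡 d) 𝓘(ℝ) ∞ (fun x ↦ (A x).det) U := by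
  simp only [Matrix.det_apply']
  refine contMDiffOn_finsetSum fun s _ ↦ ?_
  exact contMDiffOn_const.mul (contMDiffOn_finsetProd fun i _ ↦ hA _ _)

end CoordinateFrame

/-! ### The inverse metric and the dual frame -/

section DualFrame

variable {d : ℕ} {M : Type*} [TopologicalSpace M] [ChartedSpace (EuclideanSpace ℝ (Fin d)) M]
  [RiemannianBundle (fun x : M ↦ TangentSpace (𝓡 d) x)]
  {e : OpenPartialHomeomorph M (EuclideanSpace ℝ (Fin d))} {x : M}

theorem det_metricMatrix_ne_zero (he : e ∈ IsManifold.maximalAtlas (𝓡 d) ∞ M)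
    (hx : x ∈ e.source) : (metricMatrix e x).det ≠ 0 :=
  Matrix.det_gram_ne_zero_iff_linearIndependent.2 (linearIndependent_coordField he hx)

theorem metricInv_comm (e : OpenPartialHomeomorph M (EuclideanSpace ℝ (Fin d))) (x : M)
    (i j : Fin d) : metricInv e x i j = metricInv e x j i := by
  have h : (metricMatrix e x).transpose = metricMatrix e x := by
    ext i j
    exact real_inner_comm (coordField e i x) (coordField e j x)
  have h2 : (metricInv e x).transpose = metricInv e x := by
    rw [metricInv, Matrix.transpose_nonsing_inv, h]
  exact congrFun₂ h2 j i

theorem inner_coordDual_coordField (he : e ∈ IsManifold.maximalAtlas (𝓡 d) ∞ M)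
    (hx : x ∈ e.source) (j k : Fin d) :
    inner ℝ (coordDual e j x) (coordField e k x) = if j = k then 1 else 0 := by
  have h := congrFun₂ (Matrix.nonsing_inv_mul (metricMatrix e x)
    (det_metricMatrix_ne_zero he hx).isUnit) j k
  rw [Matrix.one_apply, Matrix.mul_apply] at h
  rw [← h, coordDual, sum_inner]
  refine Finset.sum_congr rfl fun i _ ↦ ?_
  rw [real_inner_smul_left, metricInv_comm]
  rfl

theorem inner_coordDual_coordDual (he : e ∈ IsManifold.maximalAtlas (𝓡 d) ∞ M)
    (hx : x ∈ e.source) (i j : Fin d) :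
    inner ℝ (coordDual e i x) (coordDual e j x) = metricInv e x i j := by
  conv_lhs => rw [coordDual, real_inner_comm, inner_sum]
  simp [real_inner_smul_right, inner_coordDual_coordField he hx, metricInv_comm e x j i]

theorem sum_inner_coordDual_smul (he : e ∈ IsManifold.maximalAtlas (𝓡 d) ∞ M)
    (hx : x ∈ e.source) (v : TangentSpace (𝓡 d) x) :
    ∑ k, inner ℝ (coordDual e k x) v • coordField e k x = v := by
  conv_rhs => rw [← sum_coordComponent_smul he hx v]
  refine Finset.sum_congr rfl fun k _ ↦ ?_
  conv_lhs => rw [← sum_coordComponent_smul he hx v, inner_sum]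
  simp [real_inner_smul_right, inner_coordDual_coordField he hx]

theorem sum_inner_coordField_smul (he : e ∈ IsManifold.maximalAtlas (𝓡 d) ∞ M)
    (hx : x ∈ e.source) (v : TangentSpace (𝓡 d) x) :
    ∑ k, inner ℝ (coordField e k x) v • coordDual e k x = v := by
  refine ext_inner_right ℝ fun w ↦ ?_
  conv_rhs => rw [← sum_inner_coordDual_smul he hx w, inner_sum]
  rw [sum_inner]
  refine Finset.sum_congr rfl fun k _ ↦ ?_
  rw [real_inner_smul_left, real_inner_smul_right, real_inner_comm v, mul_comm]

/-- The metric trace can be computed in any pair of dual frames: expand the first slot as `b k = ∑ᵢ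
⟨b k, ∂ᵢ⟩ dxⁱ`, move the coefficients to the second slot, and resum `∑ₖ ⟨b k, ∂ᵢ⟩ b k = ∂ᵢ`. Every
independence of frame or chart below comes from this. -/
theorem sum_orthonormalBasis_eq_sum_coordDual_coordField
    (he : e ∈ IsManifold.maximalAtlas (𝓡 d) ∞ M) (hx : x ∈ e.source)
    {ι : Type*} [Fintype ι] (b : OrthonormalBasis ι ℝ (TangentSpace (𝓡 d) x))
    {G : Type*} [AddCommGroup G] [Module ℝ G]
    (B : TangentSpace (𝓡 d) x →ₗ[ℝ] TangentSpace (𝓡 d) x →ₗ[ℝ] G) :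
    ∑ k, B (b k) (b k) = ∑ i, B (coordDual e i x) (coordField e i x) := by
  have h1 : ∀ k, B (b k) (b k) =
      ∑ i, inner ℝ (b k) (coordField e i x) • B (coordDual e i x) (b k) := by
    intro k
    have h := congrArg (fun v ↦ B v (b k)) (sum_inner_coordField_smul he hx (b k))
    simp only [map_sum, map_smul, LinearMap.sum_apply, LinearMap.smul_apply] at h
    rw [← h]
    exact Finset.sum_congr rfl fun i _ ↦ by rw [real_inner_comm]
  simp only [h1]
  rw [Finset.sum_comm]
  refine Finset.sum_congr rfl fun i _ ↦ ?_
  conv_rhs => rw [← b.sum_repr' (coordField e i x)]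
  simp

variable [IsManifold (𝓡 d) ∞ M] [IsContMDiffRiemannianBundle (𝓡 d) ∞ (EuclideanSpace ℝ (Fin d))
    (fun x : M ↦ TangentSpace (𝓡 d) x)]

theorem contMDiffOn_metricMatrix (he : e ∈ IsManifold.maximalAtlas (𝓡 d) ∞ M) (i j : Fin d) :
    ContMDiffOn (𝓡 d) 𝓘(ℝ) ∞ (fun x ↦ metricMatrix e x i j) e.source :=
  ContMDiffOn.inner_bundle (b := fun x : M ↦ x) (isSmoothSectionOn_coordField he i)
    (isSmoothSectionOn_coordField he j)

theorem contMDiffOn_metricInv (he : e ∈ IsManifold.maximalAtlas (𝓡 d) ∞ M) (i j : Fin d) :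
    ContMDiffOn (𝓡 d) 𝓘(ℝ) ∞ (fun x ↦ metricInv e x i j) e.source := by
  have h1 := contMDiffOn_det (contMDiffOn_metricMatrix he)
  have h2 : ContMDiffOn (𝓡 d) 𝓘(ℝ) ∞ (fun x ↦ (metricMatrix e x).adjugate i j) e.source := by
    -- Cramer's rule: an adjugate entry is the determinant of the metric matrix with one row
    -- replaced by a constant one.
    simp only [Matrix.adjugate_apply]
    refine contMDiffOn_det fun k l ↦ ?_
    by_cases h : k = j
    · subst h
      simpa using contMDiffOn_const
    · simpa [Matrix.updateRow_ne h] using contMDiffOn_metricMatrix he k l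
  have h3 := (h1.inv₀ fun x hx ↦ det_metricMatrix_ne_zero he hx).mul h2
  refine h3.congr fun x hx ↦ ?_
  simp [metricInv, Matrix.inv_def]

theorem isSmoothSectionOn_coordDual (he : e ∈ IsManifold.maximalAtlas (𝓡 d) ∞ M) (j : Fin d) :
    IsSmoothSectionOn d (EuclideanSpace ℝ (Fin d)) (coordDual e j) e.source :=
  IsSmoothSectionOn.sum fun i _ ↦
    (isSmoothSectionOn_coordField he i).smul (contMDiffOn_metricInv he i j)

end DualFrame

/-- The vector field `X` is differentiable at `x`. -/
abbrev MDifferentiableVectorFieldAt {d : ℕ} {M : Type*} [TopologicalSpace M]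
    [ChartedSpace (EuclideanSpace ℝ (Fin d)) M] [IsManifold (𝓡 d) ∞ M]
    (X : Π x : M, TangentSpace (𝓡 d) x) (x : M) : Prop :=
  MDifferentiableAt (𝓡 d) ((𝓡 d).prod 𝓘(ℝ, EuclideanSpace ℝ (Fin d)))
    (fun y ↦ TotalSpace.mk' (EuclideanSpace ℝ (Fin d)) (E := TangentSpace (𝓡 d)) y (X y)) x

/-! ### Second covariant derivatives and the connection Laplacian -/

section SecondCovariantDerivative

variable {d : ℕ} {M : Type*} [TopologicalSpace M] [ChartedSpace (EuclideanSpace ℝ (Fin d)) M]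
  {F : Type*} [NormedAddCommGroup F] [NormedSpace ℝ F]
  {V : M → Type*} [TopologicalSpace (TotalSpace F V)]
  [∀ x, AddCommGroup (V x)] [∀ x, Module ℝ (V x)] [∀ x, TopologicalSpace (V x)]
  [FiberBundle F V]
  {nab : (Π x : M, V x) → Π x : M, TangentSpace (𝓡 d) x →L[ℝ] V x}
  {σ τ : Π x : M, V x} {U : Set M} {x : M}

namespace IsCovariantDerivativeOn

theorem fun_add [VectorBundle ℝ F V] [∀ x, IsTopologicalAddGroup (V x)]
    [∀ x, ContinuousSMul ℝ (V x)] (h : IsCovariantDerivativeOn F nab Set.univ)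
    (hU : IsOpen U) (hx : x ∈ U)
    (hσ : IsSmoothSectionOn d F σ U) (hτ : IsSmoothSectionOn d F τ U) :
    nab (fun y ↦ σ y + τ y) x = nab σ x + nab τ x :=
  h.add (hσ.mdifferentiableAt hU hx) (hτ.mdifferentiableAt hU hx)

theorem fun_sum [VectorBundle ℝ F V] [∀ x, IsTopologicalAddGroup (V x)]
    [∀ x, ContinuousSMul ℝ (V x)] (h : IsCovariantDerivativeOn F nab Set.univ)
    (hU : IsOpen U) (hx : x ∈ U) {ι : Type*} (s : Finset ι) {t : ι → Π x : M, V x}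
    (ht : ∀ i, IsSmoothSectionOn d F (t i) U) :
    nab (fun y ↦ ∑ i ∈ s, t i y) x = ∑ i ∈ s, nab (t i) x := by
  classical
  induction s using Finset.induction_on with
  | empty =>
    simp only [Finset.sum_empty]
    exact h.zero
  | insert a s ha ih =>
    simp only [Finset.sum_insert ha, ← ih]
    exact h.fun_add hU hx (ht a) (IsSmoothSectionOn.sum fun i _ ↦ ht i)

theorem fun_const_smul [∀ x, IsTopologicalAddGroup (V x)] [∀ x, ContinuousSMul ℝ (V x)]
    (h : IsCovariantDerivativeOn F nab Set.univ) (hU : IsOpen U) (hx : x ∈ U) (c : ℝ)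
    (hσ : IsSmoothSectionOn d F σ U) : nab (fun y ↦ c • σ y) x = c • nab σ x :=
  h.smul_const c (hσ.mdifferentiableAt hU hx)

theorem fun_sub [VectorBundle ℝ F V] [∀ x, IsTopologicalAddGroup (V x)]
    [∀ x, ContinuousSMul ℝ (V x)] (h : IsCovariantDerivativeOn F nab Set.univ)
    (hU : IsOpen U) (hx : x ∈ U)
    (hσ : IsSmoothSectionOn d F σ U) (hτ : IsSmoothSectionOn d F τ U) :
    nab (fun y ↦ σ y - τ y) x = nab σ x - nab τ x := by
  have h1 := h.fun_add hU hx hσ (hτ.const_smul (-1))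
  rw [h.fun_const_smul hU hx (-1) hτ] at h1
  simpa [sub_eq_add_neg] using h1

theorem fun_smul [∀ x, IsTopologicalAddGroup (V x)] [∀ x, ContinuousSMul ℝ (V x)]
    (h : IsCovariantDerivativeOn F nab Set.univ) (hU : IsOpen U) (hx : x ∈ U) {f : M → ℝ}
    (hf : ContMDiffOn (𝓡 d) 𝓘(ℝ) ∞ f U)
    (hσ : IsSmoothSectionOn d F σ U) (v : TangentSpace (𝓡 d) x) :
    nab (fun y ↦ f y • σ y) x v = f x • nab σ x v + mvfderiv (𝓡 d) f x v • σ x :=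
  DFunLike.congr_fun (h.leibniz (hσ.mdifferentiableAt hU hx)
    ((hf.contMDiffAt (hU.mem_nhds hx)).mdifferentiableAt (by simp))) v

/-- Locality of connections, which allows a section to be replaced by its expression in a frame
before differentiating. -/
theorem congr_on [∀ x, IsTopologicalAddGroup (V x)] [∀ x, ContinuousSMul ℝ (V x)]
    (h : IsCovariantDerivativeOn F nab Set.univ) (hU : IsOpen U) (hx : x ∈ U)
    (hσ : IsSmoothSectionOn d F σ U) (hτ : ∀ y ∈ U, τ y = σ y) : nab τ x = nab σ x :=
  h.congr_of_eventuallyEq ((hσ.congr hτ).mdifferentiableAt hU hx) (hσ.mdifferentiableAt hU hx)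
    Filter.univ_mem (Filter.eventually_of_mem (hU.mem_nhds hx) hτ)

variable [IsManifold (𝓡 d) ∞ M] [VectorBundle ℝ F V]
  [∀ x, IsTopologicalAddGroup (V x)] [∀ x, ContinuousSMul ℝ (V x)]

/-- Smoothness of a connection on `Set.univ` speaks of global sections only. A local section agrees
near each point with a global one, and locality transfers the conclusion. -/
theorem isSmoothSectionOn_hom [T2Space M] (h : IsCovariantDerivativeOn F nab Set.univ)
    (hs : ContMDiffCovariantDerivativeOn F ∞ nab Set.univ) (hU : IsOpen U)
    (hσ : IsSmoothSectionOn d F σ U) :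
    IsSmoothSectionOn d (EuclideanSpace ℝ (Fin d) →L[ℝ] F) (nab σ) U := by
  refine IsSmoothSectionOn.of_forall_mem_nhds fun x hx ↦ ?_
  obtain ⟨τ, hτ, hτσ⟩ := hσ.exists_global hU hx
  obtain ⟨W, hW, hWo, hxW⟩ := eventually_nhds_iff.1 hτσ
  refine ⟨U ∩ W, (hU.inter hWo).mem_nhds ⟨hx, hxW⟩, ?_⟩
  have h1 : IsSmoothSectionOn d (EuclideanSpace ℝ (Fin d) →L[ℝ] F) (nab τ) Set.univ :=
    hs.contMDiff hτ
  refine (h1.mono (Set.subset_univ _)).congr fun y hy ↦ ?_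
  exact h.congr_on (hU.inter hWo) hy (hτ.mono (Set.subset_univ _)) fun z hz ↦ (hW z hz.2).symm

theorem isSmoothSectionOn_apply [T2Space M] (h : IsCovariantDerivativeOn F nab Set.univ)
    (hs : ContMDiffCovariantDerivativeOn F ∞ nab Set.univ) (hU : IsOpen U)
    (hσ : IsSmoothSectionOn d F σ U) {X : Π x : M, TangentSpace (𝓡 d) x}
    (hX : IsSmoothSectionOn d (EuclideanSpace ℝ (Fin d)) X U) :
    IsSmoothSectionOn d F (fun y ↦ nab σ y (X y)) U :=
  (h.isSmoothSectionOn_hom hs hU hσ).clm_apply hX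

variable [RiemannianBundle (fun x : M ↦ TangentSpace (𝓡 d) x)]
  [IsContMDiffRiemannianBundle (𝓡 d) ∞ (EuclideanSpace ℝ (Fin d))
    (fun x : M ↦ TangentSpace (𝓡 d) x)]

/-- The second covariant derivative `∇_X ∇_Y σ - ∇_{∇_X Y} σ` is tensorial in `X` and `Y`. -/
theorem exists_secondCovDeriv (h : IsCovariantDerivativeOn F nab Set.univ)
    (hσ : MDifferentiableAt (𝓡 d) ((𝓡 d).prod 𝓘(ℝ, EuclideanSpace ℝ (Fin d) →L[ℝ] F))
      (fun y ↦ TotalSpace.mk' (EuclideanSpace ℝ (Fin d) →L[ℝ] F)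
        (E := fun y ↦ TangentSpace (𝓡 d) y →L[ℝ] V y) y (nab σ y)) x) :
    ∃ H : TangentSpace (𝓡 d) x →L[ℝ] TangentSpace (𝓡 d) x →L[ℝ] V x,
      ∀ X Y : Π x : M, TangentSpace (𝓡 d) x,
        MDifferentiableVectorFieldAt X x → MDifferentiableVectorFieldAt Y x →
        nab (fun y ↦ nab σ y (Y y)) x (X x) - nab σ x (leviCivita (𝓡 d) Y x (X x)) =
          H (X x) (Y x) := by
  have hY' (Y : Π x : M, TangentSpace (𝓡 d) x) (hY : MDifferentiableVectorFieldAt Y x) :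
      MDifferentiableAt (𝓡 d) ((𝓡 d).prod 𝓘(ℝ, F))
        (fun y ↦ TotalSpace.mk' F y (nab σ y (Y y))) x := hσ.clm_bundle_apply hY
  have h₁ (Y : Π x : M, TangentSpace (𝓡 d) x) (_ : MDifferentiableVectorFieldAt Y x) :
      TensorialAt (𝓡 d) (EuclideanSpace ℝ (Fin d)) (fun X : Π x : M, TangentSpace (𝓡 d) x ↦
        nab (fun y ↦ nab σ y (Y y)) x (X x) - nab σ x (leviCivita (𝓡 d) Y x (X x))) x :=
    ⟨fun _ _ ↦ by simp [smul_sub], fun _ _ ↦ by simp; abel⟩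
  have h₂ (X : Π x : M, TangentSpace (𝓡 d) x) (_ : MDifferentiableVectorFieldAt X x) :
      TensorialAt (𝓡 d) (EuclideanSpace ℝ (Fin d)) (fun Y : Π x : M, TangentSpace (𝓡 d) x ↦
        nab (fun y ↦ nab σ y (Y y)) x (X x) - nab σ x (leviCivita (𝓡 d) Y x (X x))) x := by
    refine ⟨fun {f Y} hf hY ↦ ?_, fun {Y Z} hY hZ ↦ ?_⟩
    -- Replacing `Y` by `f • Y` produces `df(X) ∇_Y σ` in both terms, once from `nab` and once from
    -- `leviCivita`, and the two cancel. Linearity in `X` is immediate because `X` enters only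
    -- through `X x`.
    · have h1 := DFunLike.congr_fun (h.leibniz (hY' Y hY) hf) (X x)
      have h2 := DFunLike.congr_fun ((leviCivita (𝓡 d)).isCovariantDerivativeOnUniv.leibniz
        hY hf) (X x)
      have h3 : (fun y ↦ nab σ y ((f • Y) y)) = f • fun y ↦ nab σ y (Y y) := by
        ext y
        simp
      simp only [h3, h1, h2]
      simp [smul_sub]
    · have h1 := DFunLike.congr_fun (h.add (hY' Y hY) (hY' Z hZ)) (X x)
      have h2 := DFunLike.congr_fun ((leviCivita (𝓡 d)).isCovariantDerivativeOnUniv.add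
        hY hZ) (X x)
      have h3 : (fun y ↦ nab σ y ((Y + Z) y)) =
          (fun y ↦ nab σ y (Y y)) + fun y ↦ nab σ y (Z y) := by
        ext y
        simp
      simp only [h3, h1, h2]
      simp
      abel
  exact ⟨TensorialAt.mkHom₂ _ x h₁ h₂, fun X Y hX hY ↦ (TensorialAt.mkHom₂_apply h₁ h₂ hX hY).symm⟩

end IsCovariantDerivativeOn

end SecondCovariantDerivative

section Laplacian

variable {d : ℕ} {M : Type*} [TopologicalSpace M] [ChartedSpace (EuclideanSpace ℝ (Fin d)) M]
  {V : M → Type*} [∀ x, AddCommGroup (V x)] [∀ x, Module ℂ (V x)] [∀ x, TopologicalSpace (V x)]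
  [∀ x, IsTopologicalAddGroup (V x)] [∀ x, ContinuousSMul ℂ (V x)]
  {nab : (Π x : M, V x) → Π x : M, TangentSpace (𝓡 d) x →L[ℝ] V x}
  {σ : Π x : M, V x} {U : Set M} {x : M}
  [RiemannianBundle (fun x : M ↦ TangentSpace (𝓡 d) x)]
  {e : OpenPartialHomeomorph M (EuclideanSpace ℝ (Fin d))}

theorem sum_metricInv_smul_bilinear (e : OpenPartialHomeomorph M (EuclideanSpace ℝ (Fin d)))
    (H : TangentSpace (𝓡 d) x →L[ℝ] TangentSpace (𝓡 d) x →L[ℝ] V x) :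
    ∑ i, ∑ j, metricInv e x i j • H (coordField e i x) (coordField e j x) =
      ∑ j, H (coordDual e j x) (coordField e j x) := by
  rw [Finset.sum_comm]
  simp [coordDual]

variable [IsManifold (𝓡 d) ∞ M] [IsContMDiffRiemannianBundle (𝓡 d) ∞ (EuclideanSpace ℝ (Fin d))
    (fun x : M ↦ TangentSpace (𝓡 d) x)]

theorem sum_christoffel_smul (he : e ∈ IsManifold.maximalAtlas (𝓡 d) ∞ M) (hx : x ∈ e.source)
    (i j : Fin d) : ∑ k, christoffel e i j k x • coordField e k x =
      leviCivita (𝓡 d) (coordField e j) x (coordField e i x) :=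
  sum_coordComponent_smul he hx _

/-- The Christoffel terms reassemble `∇_{∂ᵢ} ∂ⱼ`, so each summand is `gⁱʲ H(∂ᵢ, ∂ⱼ)` and the
Laplacian is minus the trace of `H`. -/
theorem laplacianInChart_eq_neg_sum (he : e ∈ IsManifold.maximalAtlas (𝓡 d) ∞ M)
    (hx : x ∈ e.source) {H : TangentSpace (𝓡 d) x →L[ℝ] TangentSpace (𝓡 d) x →L[ℝ] V x}
    (hH : ∀ X Y : Π x : M, TangentSpace (𝓡 d) x,
      MDifferentiableVectorFieldAt X x → MDifferentiableVectorFieldAt Y x →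
        nab (fun y ↦ nab σ y (Y y)) x (X x) - nab σ x (leviCivita (𝓡 d) Y x (X x)) =
          H (X x) (Y x)) :
    laplacianInChart e nab σ x = -∑ j, H (coordDual e j x) (coordField e j x) := by
  have hX (i : Fin d) : MDifferentiableVectorFieldAt (coordField e i) x :=
    (isSmoothSectionOn_coordField he i).mdifferentiableAt e.open_source hx
  rw [← sum_metricInv_smul_bilinear, laplacianInChart]
  congr! with i _ j _
  rw [← hH _ _ (hX i) (hX j), ← sum_christoffel_smul he hx]
  simp

/-- Both charts compute minus the trace of the same bilinear map `H`, which was constructed without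
reference to a chart. -/
theorem laplacianInChart_eq_laplacianInChart (he : e ∈ IsManifold.maximalAtlas (𝓡 d) ∞ M)
    (hx : x ∈ e.source) {e' : OpenPartialHomeomorph M (EuclideanSpace ℝ (Fin d))}
    (he' : e' ∈ IsManifold.maximalAtlas (𝓡 d) ∞ M) (hx' : x ∈ e'.source)
    [T2Space M] {F : Type*} [NormedAddCommGroup F] [NormedSpace ℂ F]
    [TopologicalSpace (TotalSpace F V)] [FiberBundle F V] [VectorBundle ℂ F V]
    (h : IsCovariantDerivativeOn F nab Set.univ)
    (hs : ContMDiffCovariantDerivativeOn F ∞ nab Set.univ) (hU : IsOpen U)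
    (hσ : IsSmoothSectionOn d F σ U) (hxU : x ∈ U) :
    laplacianInChart e nab σ x = laplacianInChart e' nab σ x := by
  obtain ⟨H, hH⟩ := h.exists_secondCovDeriv
    ((h.isSmoothSectionOn_hom hs hU hσ).mdifferentiableAt hU hxU)
  let B : TangentSpace (𝓡 d) x →ₗ[ℝ] TangentSpace (𝓡 d) x →ₗ[ℝ] V x :=
    LinearMap.mk₂ ℝ (fun v w ↦ H v w) (by simp) (by simp) (by simp) (by simp)
  rw [laplacianInChart_eq_neg_sum he hx hH, laplacianInChart_eq_neg_sum he' hx' hH]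
  exact congrArg Neg.neg ((sum_orthonormalBasis_eq_sum_coordDual_coordField he hx
    (stdOrthonormalBasis ℝ _) B).symm.trans
    (sum_orthonormalBasis_eq_sum_coordDual_coordField he' hx' (stdOrthonormalBasis ℝ _) B))

end Laplacian

/-! ### Smoothness of the operators attached to a Dirac bundle -/

section DiracSmoothness

variable {d : ℕ} {M : Type*} [TopologicalSpace M] [ChartedSpace (EuclideanSpace ℝ (Fin d)) M]
  {F : Type*} [NormedAddCommGroup F] [NormedSpace ℂ F]
  {E : M → Type*} [TopologicalSpace (TotalSpace F E)]
  [∀ x, AddCommGroup (E x)] [∀ x, Module ℂ (E x)] [∀ x, TopologicalSpace (E x)]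
  [∀ x, IsTopologicalAddGroup (E x)] [∀ x, ContinuousSMul ℂ (E x)]
  [FiberBundle F E] [VectorBundle ℂ F E]
  {γ : Π x : M, TangentSpace (𝓡 d) x →ₗ[ℝ] (E x →L[ℂ] E x)}
  {nab : (Π x : M, E x) → Π x : M, TangentSpace (𝓡 d) x →L[ℝ] E x}
  {ψ : Π x : M, E x →L[ℂ] E x} {σ τ : Π x : M, E x} {U : Set M} {x : M}
  {X : Π x : M, TangentSpace (𝓡 d) x}

/-- Smoothness is a real notion, so complex scalars need a separate argument: trivializations are
complex-linear, which reduces the claim to multiplication by `c` on `F`. -/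
theorem IsSmoothSectionOn.const_csmul (c : ℂ) (hσ : IsSmoothSectionOn d F σ U) :
    IsSmoothSectionOn d F (fun x ↦ c • σ x) U := by
  intro x hx
  have h := (contMDiffWithinAt_section (𝕜 := ℝ) (F := F)).1 (hσ x hx)
  refine (contMDiffWithinAt_section (𝕜 := ℝ) (F := F)).2 ?_
  let A : F →L[ℝ] F := (c • ContinuousLinearMap.id ℂ F).restrictScalars ℝ
  have h2 := A.contMDiff.contMDiffAt.comp_contMDiffWithinAt x (n := ∞) h
  refine h2.congr_of_eventuallyEq_of_mem ?_ hx
  have hxt := mem_baseSet_trivializationAt' (F := F) (E := E) x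
  filter_upwards [mem_nhdsWithin_of_mem_nhds
    ((trivializationAt F E x).open_baseSet.mem_nhds hxt)] with y hy
  exact ((trivializationAt F E x).linear ℂ hy).map_smul c (σ y)

theorem IsSmoothEnd.isSmoothSectionOn_apply (hψ : IsSmoothEnd d F ψ)
    (hσ : IsSmoothSectionOn d F σ U) : IsSmoothSectionOn d F (fun y ↦ ψ y (σ y)) U := by
  have h : IsSmoothSectionOn d (F →L[ℝ] F) (fun y ↦ (ψ y).restrictScalars ℝ) U := hψ.contMDiffOn
  exact h.clm_apply hσ

/-- Replacing the complex scalar `1 / 2` by the real one lets all later identities be solved over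
`ℝ`. -/
theorem potentialForm_apply (v : TangentSpace (𝓡 d) x) (w : E x) :
    potentialForm γ ψ x v w = (1 / 2 : ℝ) • (γ x v (ψ x w) + ψ x (γ x v w)) := by
  have h : ((1 / 2 : ℂ)) = (((1 / 2 : ℝ) : ℝ) : ℂ) := by norm_num
  rw [potentialForm, h]
  exact Complex.coe_smul _ _

theorem potentialForm_add (v v' : TangentSpace (𝓡 d) x) (w : E x) :
    potentialForm γ ψ x (v + v') w = potentialForm γ ψ x v w + potentialForm γ ψ x v' w := by
  simp only [potentialForm_apply, map_add, add_apply, ← smul_add]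
  congr 1
  abel

theorem potentialForm_smul (r : ℝ) (v : TangentSpace (𝓡 d) x) (w : E x) :
    potentialForm γ ψ x (r • v) w = r • potentialForm γ ψ x v w := by
  simp only [potentialForm_apply, map_smul, smul_apply,
    ContinuousLinearMap.map_smul_of_tower, ← smul_add]
  rw [smul_comm]

variable [RiemannianBundle (fun x : M ↦ TangentSpace (𝓡 d) x)]

theorem shiftedConnection_apply (v : TangentSpace (𝓡 d) x) :
    shiftedConnection γ nab ψ σ x v = nab σ x v - potentialForm γ ψ x v (σ x) := rfl

variable [IsManifold (𝓡 d) ∞ M]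

theorem IsCliffordAction.isSmoothSectionOn_apply (hγ : IsCliffordAction F γ)
    (hX : IsSmoothSectionOn d (EuclideanSpace ℝ (Fin d)) X U) (hσ : IsSmoothSectionOn d F σ U) :
    IsSmoothSectionOn d F (fun y ↦ γ y (X y) (σ y)) U := by
  obtain ⟨Γ, hΓ, hΓγ⟩ := hγ.smooth
  have h : IsSmoothSectionOn d (EuclideanSpace ℝ (Fin d) →L[ℝ] F →L[ℝ] F) Γ U := hΓ.contMDiffOn
  exact ((h.clm_apply hX).clm_apply hσ).congr fun y _ ↦ (hΓγ _ _ _).symm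

theorem isSmoothSectionOn_potentialForm (hγ : IsCliffordAction F γ) (hψ : IsSmoothEnd d F ψ)
    (hX : IsSmoothSectionOn d (EuclideanSpace ℝ (Fin d)) X U) (hσ : IsSmoothSectionOn d F σ U) :
    IsSmoothSectionOn d F (fun y ↦ potentialForm γ ψ y (X y) (σ y)) U := by
  simp only [potentialForm_apply]
  exact ((hγ.isSmoothSectionOn_apply hX (hψ.isSmoothSectionOn_apply hσ)).add
    (hψ.isSmoothSectionOn_apply (hγ.isSmoothSectionOn_apply hX hσ))).const_smul _

/-- `L` is a smooth one-form with values in complex-linear endomorphisms, so subtracting it leaves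
both Leibniz rules intact. -/
theorem isSmoothConnection_shiftedConnection [T2Space M] [ContMDiffVectorBundle ∞ F E (𝓡 d)]
    (hγ : IsCliffordAction F γ) (hnab : IsSmoothConnection F nab) (hψ : IsSmoothEnd d F ψ) :
    IsSmoothConnection F (shiftedConnection γ nab ψ) where
  isCovariantDerivative :=
    { add := by
        intro σ τ x hσ hτ _
        ext v
        simp only [shiftedConnection_apply, hnab.isCovariantDerivative.add hσ hτ, add_apply,
          Pi.add_apply, map_add]
        abel
      leibniz := by
        intro σ f x hσ hf _
        ext v
        simp only [shiftedConnection_apply, hnab.isCovariantDerivative.leibniz hσ hf, add_apply,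
          smul_apply, Pi.smul_apply', ContinuousLinearMap.map_smul_of_tower, smul_sub]
        abel }
  complex_leibniz := by
    intro σ f x hσ hf v
    simp only [shiftedConnection_apply, hnab.complex_leibniz hσ hf, map_smul, smul_sub]
    abel
  contMDiff :=
    { contMDiff := by
        intro σ hσ
        have hσ' : IsSmoothSectionOn d F σ Set.univ := hσ
        refine isSmoothSectionOn_hom isOpen_univ fun W hW hWo X hX ↦ ?_
        exact (hnab.isCovariantDerivative.isSmoothSectionOn_apply hnab.contMDiff hWo
          (hσ'.mono hW) hX).sub (isSmoothSectionOn_potentialForm hγ hψ hX (hσ'.mono hW)) }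

end DiracSmoothness

/-! ### The Weitzenböck formula -/

section LeviCivitaFrame

variable {d : ℕ} {M : Type*} [TopologicalSpace M] [ChartedSpace (EuclideanSpace ℝ (Fin d)) M]
  [RiemannianBundle (fun x : M ↦ TangentSpace (𝓡 d) x)]
  {e : OpenPartialHomeomorph M (EuclideanSpace ℝ (Fin d))} {x : M}

/-- The traces of `B` and `B.flip` agree in an orthonormal basis, where both slots hold the same
vector. -/
theorem sum_coordDual_coordField_comm
    (he : e ∈ IsManifold.maximalAtlas (𝓡 d) ∞ M) (hx : x ∈ e.source)
    {G : Type*} [AddCommGroup G] [Module ℝ G]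
    (B : TangentSpace (𝓡 d) x →ₗ[ℝ] TangentSpace (𝓡 d) x →ₗ[ℝ] G) :
    ∑ i, B (coordDual e i x) (coordField e i x) = ∑ i, B (coordField e i x) (coordDual e i x) :=
  (sum_orthonormalBasis_eq_sum_coordDual_coordField he hx (stdOrthonormalBasis ℝ _) B).symm.trans
    (sum_orthonormalBasis_eq_sum_coordDual_coordField he hx (stdOrthonormalBasis ℝ _) B.flip)

variable [IsManifold (𝓡 d) ∞ M] [IsContMDiffRiemannianBundle (𝓡 d) ∞ (EuclideanSpace ℝ (Fin d))
    (fun x : M ↦ TangentSpace (𝓡 d) x)]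

/-- Metric compatibility applied to the function `⟨dxʲ, ∂ₖ⟩`, which is constant on the chart domain.
-/
theorem inner_leviCivita_coordDual (he : e ∈ IsManifold.maximalAtlas (𝓡 d) ∞ M)
    (hx : x ∈ e.source) (i j k : Fin d) :
    inner ℝ (leviCivita (𝓡 d) (coordDual e j) x (coordField e i x)) (coordField e k x) =
      -inner ℝ (coordDual e j x) (leviCivita (𝓡 d) (coordField e k) x (coordField e i x)) := by
  have hX (i : Fin d) := (isSmoothSectionOn_coordField he i).mdifferentiableAt e.open_source hx
  have hY := (isSmoothSectionOn_coordDual he j).mdifferentiableAt e.open_source hx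
  have h := leviCivita_metric (𝓡 d) (hX i) hY (hX k)
  have h2 : (fun y ↦ inner ℝ (coordDual e j y) (coordField e k y)) =ᶠ[𝓝 x]
      fun _ ↦ (if j = k then 1 else 0 : ℝ) := by
    filter_upwards [e.open_source.mem_nhds hx] with y hy
    exact inner_coordDual_coordField he hy j k
  have h3 : mvfderiv (𝓡 d) (fun y ↦ inner ℝ (coordDual e j y) (coordField e k y)) x
      (coordField e i x) = 0 := by
    have h4 := ((hasMFDerivAt_const (I := 𝓡 d) (I' := 𝓘(ℝ)) (if j = k then 1 else 0 : ℝ)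
      x).congr_of_eventuallyEq h2).mfderiv
    rw [mvfderiv, h4]
    rfl
  rw [h3] at h
  linarith

theorem leviCivita_coordDual (he : e ∈ IsManifold.maximalAtlas (𝓡 d) ∞ M)
    (hx : x ∈ e.source) (i j : Fin d) :
    leviCivita (𝓡 d) (coordDual e j) x (coordField e i x) =
      -∑ k, inner ℝ (coordDual e j x) (leviCivita (𝓡 d) (coordField e k) x (coordField e i x)) •
        coordDual e k x := by
  rw [← Finset.sum_neg_distrib,
    ← sum_inner_coordField_smul he hx (leviCivita (𝓡 d) (coordDual e j) x (coordField e i x))]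
  refine Finset.sum_congr rfl fun k _ ↦ ?_
  rw [real_inner_comm, inner_leviCivita_coordDual he hx, neg_smul]

theorem leviCivita_sub_leviCivita {X Y : Π x : M, TangentSpace (𝓡 d) x}
    (hX : MDifferentiableVectorFieldAt X x) (hY : MDifferentiableVectorFieldAt Y x) :
    leviCivita (𝓡 d) Y x (X x) - leviCivita (𝓡 d) X x (Y x) = mlieBracket (𝓡 d) X Y x :=
  (CovariantDerivative.torsion_eq_zero_iff _).1 (leviCivita_torsion (𝓡 d)) hX hY

end LeviCivitaFrame

/-! ### Clifford splitting and the Dirac operator in a frame -/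

section Weitzenbock

variable {d : ℕ} {M : Type*} [TopologicalSpace M] [ChartedSpace (EuclideanSpace ℝ (Fin d)) M]
  [IsManifold (𝓡 d) ∞ M] [RiemannianBundle (fun x : M ↦ TangentSpace (𝓡 d) x)]
  {F : Type*} [NormedAddCommGroup F] [NormedSpace ℂ F]
  {E : M → Type*} [TopologicalSpace (TotalSpace F E)]
  [∀ x, AddCommGroup (E x)] [∀ x, Module ℂ (E x)] [∀ x, TopologicalSpace (E x)]
  [∀ x, IsTopologicalAddGroup (E x)] [∀ x, ContinuousSMul ℂ (E x)]
  [FiberBundle F E] [VectorBundle ℂ F E]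
  {γ : Π x : M, TangentSpace (𝓡 d) x →ₗ[ℝ] (E x →L[ℂ] E x)}
  {nab : (Π x : M, E x) → Π x : M, TangentSpace (𝓡 d) x →L[ℝ] E x}
  {ψ : Π x : M, E x →L[ℂ] E x} {σ τ : Π x : M, E x} {U : Set M} {x : M}
  {e : OpenPartialHomeomorph M (EuclideanSpace ℝ (Fin d))}

/-- Splitting `γⁱγʲHᵢⱼ` into its symmetric and antisymmetric parts. -/
theorem IsCliffordAction.sum_sum_coordDual (hγ : IsCliffordAction F γ)
    (he : e ∈ IsManifold.maximalAtlas (𝓡 d) ∞ M) (hx : x ∈ e.source)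
    (H : TangentSpace (𝓡 d) x →L[ℝ] TangentSpace (𝓡 d) x →L[ℝ] E x) :
    ∑ i, ∑ j, γ x (coordDual e i x) (γ x (coordDual e j x)
        (H (coordField e i x) (coordField e j x))) =
      -∑ j, H (coordDual e j x) (coordField e j x) +
      (1 / 2 : ℝ) • ∑ i, ∑ j, γ x (coordDual e i x) (γ x (coordDual e j x)
        (H (coordField e i x) (coordField e j x) - H (coordField e j x) (coordField e i x))) := by
  rw [← sum_metricInv_smul_bilinear]
  set S := ∑ i, ∑ j, γ x (coordDual e i x) (γ x (coordDual e j x)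
    (H (coordField e i x) (coordField e j x))) with hS
  set T := ∑ i, ∑ j, metricInv e x i j • H (coordField e i x) (coordField e j x) with hT
  -- With `S'` the sum with the arguments of `H` exchanged, the Clifford relation gives `S + S' =
  -- -2T`. The lemma is then `S = ½(S + S') + ½(S - S')`.
  have h : ∑ i, ∑ j, γ x (coordDual e i x) (γ x (coordDual e j x)
      (H (coordField e j x) (coordField e i x))) = (-2 : ℝ) • T - S := by
    rw [Finset.sum_comm, hT, hS]
    simp only [Finset.smul_sum, ← Finset.sum_sub_distrib]
    refine Finset.sum_congr rfl fun i _ ↦ Finset.sum_congr rfl fun j _ ↦ ?_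
    have h1 := hγ.clifford x (coordDual e i x) (coordDual e j x)
      (H (coordField e i x) (coordField e j x))
    rw [inner_coordDual_coordDual he hx] at h1
    rw [eq_sub_iff_add_eq, add_comm, h1, smul_smul]
    congr 1
    ring
  simp only [map_sub, Finset.sum_sub_distrib]
  rw [h, ← hS]
  module

theorem diracOperator_eq_sum (he : e ∈ IsManifold.maximalAtlas (𝓡 d) ∞ M) (hx : x ∈ e.source) :
    diracOperator γ nab ψ σ x =
      ∑ j, γ x (coordDual e j x) (nab σ x (coordField e j x)) + ψ x (σ x) := by
  let B : TangentSpace (𝓡 d) x →ₗ[ℝ] TangentSpace (𝓡 d) x →ₗ[ℝ] E x :=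
    LinearMap.mk₂ ℝ (fun v w ↦ γ x v (nab σ x w)) (by simp) (by simp) (by simp)
      (by simp [ContinuousLinearMap.map_smul_of_tower])
  rw [diracOperator]
  congr 1
  exact sum_orthonormalBasis_eq_sum_coordDual_coordField he hx (stdOrthonormalBasis ℝ _) B

variable [IsContMDiffRiemannianBundle (𝓡 d) ∞ (EuclideanSpace ℝ (Fin d))
    (fun x : M ↦ TangentSpace (𝓡 d) x)]

theorem IsDiracBundle.nab_clifford (hD : IsDiracBundle F γ nab) (hU : IsOpen U) (hx : x ∈ U)
    {Y : Π x : M, TangentSpace (𝓡 d) x}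
    (hY : IsSmoothSectionOn d (EuclideanSpace ℝ (Fin d)) Y U) (hσ : IsSmoothSectionOn d F σ U)
    (v : TangentSpace (𝓡 d) x) :
    nab (fun y ↦ γ y (Y y) (σ y)) x v =
      γ x (leviCivita (𝓡 d) Y x v) (σ x) + γ x (Y x) (nab σ x v) :=
  hD.compatible (hY.mdifferentiableAt hU hx) (hσ.mdifferentiableAt hU hx) v

/-- The covariant derivative of the frame expression of the Dirac operator. -/
theorem IsDiracBundle.nab_sum_coordDual [T2Space M] (hD : IsDiracBundle F γ nab)
    (he : e ∈ IsManifold.maximalAtlas (𝓡 d) ∞ M) (hU : IsOpen U) (hUe : U ⊆ e.source)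
    (hσ : IsSmoothSectionOn d F σ U) (hx : x ∈ U)
    {H : TangentSpace (𝓡 d) x →L[ℝ] TangentSpace (𝓡 d) x →L[ℝ] E x}
    (hH : ∀ X Y : Π x : M, TangentSpace (𝓡 d) x,
      MDifferentiableVectorFieldAt X x → MDifferentiableVectorFieldAt Y x →
        nab (fun y ↦ nab σ y (Y y)) x (X x) - nab σ x (leviCivita (𝓡 d) Y x (X x)) =
          H (X x) (Y x)) (i : Fin d) :
    nab (fun y ↦ ∑ j, γ y (coordDual e j y) (nab σ y (coordField e j y))) x (coordField e i x) =
      ∑ j, γ x (coordDual e j x) (H (coordField e i x) (coordField e j x)) := by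
  have hc := hD.isSmoothConnection.isCovariantDerivative
  have hs := hD.isSmoothConnection.contMDiff
  have hX (j : Fin d) := (isSmoothSectionOn_coordField he j).mono hUe
  have hY (j : Fin d) := (isSmoothSectionOn_coordDual he j).mono hUe
  have hnX (j : Fin d) : IsSmoothSectionOn d F (fun y ↦ nab σ y (coordField e j y)) U :=
    hc.isSmoothSectionOn_apply hs hU hσ (hX j)
  have hXd (j : Fin d) : MDifferentiableVectorFieldAt (coordField e j) x :=
    (hX j).mdifferentiableAt hU hx
  rw [hc.fun_sum hU hx _
    fun j ↦ hD.isCliffordAction.isSmoothSectionOn_apply (hY j) (hnX j), sum_apply]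
  simp only [hD.nab_clifford hU hx (hY _) (hnX _), ← hH _ _ (hXd _) (hXd _), map_sub]
  rw [Finset.sum_add_distrib, Finset.sum_sub_distrib, add_comm, sub_eq_add_neg]
  congr 1
  -- Differentiating the dual frame gives `∑ⱼ γ(∇ᵢ dxʲ)∇̃ⱼσ = -∑ₖ γ(dxᵏ)∇̃_{∇ᵢ∂ₖ}σ`, which is the
  -- correction turning iterated derivatives into `H`.
  simp only [leviCivita_coordDual he (hUe hx), map_neg, map_sum, map_smul, neg_apply, sum_apply,
    smul_apply, Finset.sum_neg_distrib]
  rw [Finset.sum_comm]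
  congr 1
  refine Finset.sum_congr rfl fun k _ ↦ ?_
  conv_rhs => rw [← sum_inner_coordDual_smul he (hUe hx)
    (leviCivita (𝓡 d) (coordField e k) x (coordField e i x))]
  simp only [map_sum, map_smul, ContinuousLinearMap.map_smul_of_tower]

end Weitzenbock

/-! ### The square of the Dirac operator in a chart -/

section WeitzenbockFormula

variable {d : ℕ} {M : Type*} [TopologicalSpace M] [ChartedSpace (EuclideanSpace ℝ (Fin d)) M]
  [IsManifold (𝓡 d) ∞ M] [RiemannianBundle (fun x : M ↦ TangentSpace (𝓡 d) x)]
  [IsContMDiffRiemannianBundle (𝓡 d) ∞ (EuclideanSpace ℝ (Fin d))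
    (fun x : M ↦ TangentSpace (𝓡 d) x)]
  {F : Type*} [NormedAddCommGroup F] [NormedSpace ℂ F]
  {E : M → Type*} [TopologicalSpace (TotalSpace F E)]
  [∀ x, AddCommGroup (E x)] [∀ x, Module ℂ (E x)] [∀ x, TopologicalSpace (E x)]
  [∀ x, IsTopologicalAddGroup (E x)] [∀ x, ContinuousSMul ℂ (E x)]
  [FiberBundle F E] [VectorBundle ℂ F E]
  {γ : Π x : M, TangentSpace (𝓡 d) x →ₗ[ℝ] (E x →L[ℂ] E x)}
  {nab : (Π x : M, E x) → Π x : M, TangentSpace (𝓡 d) x →L[ℝ] E x}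
  {ψ : Π x : M, E x →L[ℂ] E x} {σ τ : Π x : M, E x} {U : Set M} {x : M}
  {e : OpenPartialHomeomorph M (EuclideanSpace ℝ (Fin d))}

/-- Absence of torsion: `[X, Y] = ∇_X Y - ∇_Y X` splits the bracket term between the two second
covariant derivatives. -/
theorem curvature_eq_sub
    {H : TangentSpace (𝓡 d) x →L[ℝ] TangentSpace (𝓡 d) x →L[ℝ] E x}
    (hH : ∀ X Y : Π x : M, TangentSpace (𝓡 d) x,
      MDifferentiableVectorFieldAt X x → MDifferentiableVectorFieldAt Y x →
        nab (fun y ↦ nab σ y (Y y)) x (X x) - nab σ x (leviCivita (𝓡 d) Y x (X x)) =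
          H (X x) (Y x))
    {X Y : Π x : M, TangentSpace (𝓡 d) x}
    (hX : MDifferentiableVectorFieldAt X x) (hY : MDifferentiableVectorFieldAt Y x) :
    curvature nab X Y σ x = H (X x) (Y x) - H (Y x) (X x) := by
  rw [curvature, ← leviCivita_sub_leviCivita hX hY, map_sub, ← hH X Y hX hY, ← hH Y X hY hX]
  abel

/-- The second covariant derivative of `nab - L` in terms of that of `nab`. -/
theorem IsDiracBundle.shiftedConnection_shiftedConnection [T2Space M] (hD : IsDiracBundle F γ nab)
    (hψ : IsSmoothEnd d F ψ) (hU : IsOpen U) (hσ : IsSmoothSectionOn d F σ U) (hx : x ∈ U)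
    {X Y : Π x : M, TangentSpace (𝓡 d) x}
    (hY : IsSmoothSectionOn d (EuclideanSpace ℝ (Fin d)) Y U) :
    shiftedConnection γ nab ψ (fun y ↦ shiftedConnection γ nab ψ σ y (Y y)) x (X x)
        - shiftedConnection γ nab ψ σ x (leviCivita (𝓡 d) Y x (X x)) =
      nab (fun y ↦ nab σ y (Y y)) x (X x) - nab σ x (leviCivita (𝓡 d) Y x (X x))
      - (1 / 2 : ℝ) • (γ x (Y x) (nab (fun y ↦ ψ y (σ y)) x (X x))
        + nab (fun y ↦ ψ y (γ y (Y y) (σ y))) x (X x)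
        - ψ x (nab (fun y ↦ γ y (Y y) (σ y)) x (X x))
        + ψ x (γ x (Y x) (nab σ x (X x))))
      - potentialForm γ ψ x (X x) (nab σ x (Y x))
      + potentialForm γ ψ x (X x) (potentialForm γ ψ x (Y x) (σ x)) := by
  have hc := hD.isSmoothConnection.isCovariantDerivative
  have hγ := hD.isCliffordAction
  have hψσ := hψ.isSmoothSectionOn_apply hσ
  have h1 := hγ.isSmoothSectionOn_apply hY hψσ
  have h2 := hψ.isSmoothSectionOn_apply (hγ.isSmoothSectionOn_apply hY hσ)
  have h3 : nab (fun y ↦ potentialForm γ ψ y (Y y) (σ y)) x (X x) =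
      (1 / 2 : ℝ) • (nab (fun y ↦ γ y (Y y) (ψ y (σ y))) x (X x)
        + nab (fun y ↦ ψ y (γ y (Y y) (σ y))) x (X x)) := by
    simp only [potentialForm_apply]
    rw [hc.fun_const_smul hU hx _ (h1.add h2), hc.fun_add hU hx h1 h2]
    rfl
  -- The terms `γ(∇_X Y)ψσ` cancel. The term `ψγ(∇_X Y)σ` is expressed by compatibility through
  -- `ψ∇̃_X(γ(Y)σ)`, leaving the difference `∇̃_X(ψγ(Y)σ) - ψ∇̃_X(γ(Y)σ)` that `endConnection`
  -- produces in `weitzenbockTerm`.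
  simp only [shiftedConnection_apply]
  rw [hc.fun_sub hU hx (hc.isSmoothSectionOn_apply hD.isSmoothConnection.contMDiff hU hσ hY)
    (isSmoothSectionOn_potentialForm hγ hψ hY hσ), sub_apply, h3,
    hD.nab_clifford hU hx hY hψσ, hD.nab_clifford hU hx hY hσ, map_sub,
    potentialForm_apply (leviCivita (𝓡 d) Y x (X x)), map_add]
  module

theorem IsDiracBundle.isSmoothSectionOn_sum_coordDual [T2Space M] (hD : IsDiracBundle F γ nab)
    (he : e ∈ IsManifold.maximalAtlas (𝓡 d) ∞ M) (hU : IsOpen U)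
    (hUe : U ⊆ e.source) (hσ : IsSmoothSectionOn d F σ U) :
    IsSmoothSectionOn d F (fun y ↦ ∑ j, γ y (coordDual e j y) (nab σ y (coordField e j y))) U :=
  IsSmoothSectionOn.sum fun j _ ↦ hD.isCliffordAction.isSmoothSectionOn_apply
    ((isSmoothSectionOn_coordDual he j).mono hUe)
    (hD.isSmoothConnection.isCovariantDerivative.isSmoothSectionOn_apply
      hD.isSmoothConnection.contMDiff hU hσ ((isSmoothSectionOn_coordField he j).mono hUe))

/-- The Weitzenböck formula at a point, for sections smooth only near it. Both sides are reduced to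
the second covariant derivative `H` of `nab` plus first order terms, after which the identity is
linear algebra. -/
theorem IsDiracBundle.diracOperator_diracOperator [T2Space M]
    [ContMDiffVectorBundle ∞ F E (𝓡 d)] (hD : IsDiracBundle F γ nab)
    (hψ : IsSmoothEnd d F ψ) (he : e ∈ IsManifold.maximalAtlas (𝓡 d) ∞ M) (hU : IsOpen U)
    (hUe : U ⊆ e.source) (hσ : IsSmoothSectionOn d F σ U) (hx : x ∈ U) :
    diracOperator γ nab ψ (diracOperator γ nab ψ σ) x =
      laplacianInChart e (shiftedConnection γ nab ψ) σ x + weitzenbockTerm e γ nab ψ σ x := by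
  have hc := hD.isSmoothConnection.isCovariantDerivative
  have hs := hD.isSmoothConnection.contMDiff
  have hS := isSmoothConnection_shiftedConnection hD.isCliffordAction hD.isSmoothConnection hψ
  have hX (j : Fin d) := (isSmoothSectionOn_coordField he j).mono hUe
  have hY (j : Fin d) := (isSmoothSectionOn_coordDual he j).mono hUe
  have hXd (j : Fin d) : MDifferentiableVectorFieldAt (coordField e j) x :=
    (hX j).mdifferentiableAt hU hx
  have hYd (j : Fin d) : MDifferentiableVectorFieldAt (coordDual e j) x :=
    (hY j).mdifferentiableAt hU hx
  have hψσ := hψ.isSmoothSectionOn_apply hσ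
  have hDσ := hD.isSmoothSectionOn_sum_coordDual he hU hUe hσ
  obtain ⟨H, hH⟩ := hc.exists_secondCovDeriv
    ((hc.isSmoothSectionOn_hom hs hU hσ).mdifferentiableAt hU hx)
  obtain ⟨H', hH'⟩ := hS.isCovariantDerivative.exists_secondCovDeriv
    ((hS.isCovariantDerivative.isSmoothSectionOn_hom hS.contMDiff hU hσ).mdifferentiableAt hU hx)
  -- The Laplacian trace comes with the dual frame in the first slot. The computation differentiates
  -- along `∂ᵢ` with `dxⁱ` in the second slot, so that `γ(Y)` becomes `γⁱ`; the three swaps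
  -- reconcile the orders.
  have swap (H : TangentSpace (𝓡 d) x →L[ℝ] TangentSpace (𝓡 d) x →L[ℝ] E x) :
      ∑ j, H (coordDual e j x) (coordField e j x) = ∑ j, H (coordField e j x) (coordDual e j x) :=
    sum_coordDual_coordField_comm he (hUe hx)
      (LinearMap.mk₂ ℝ (fun v w ↦ H v w) (by simp) (by simp) (by simp) (by simp))
  have swapL : ∑ j, potentialForm γ ψ x (coordDual e j x) (nab σ x (coordField e j x)) =
      ∑ j, potentialForm γ ψ x (coordField e j x) (nab σ x (coordDual e j x)) :=
    sum_coordDual_coordField_comm he (hUe hx)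
      (LinearMap.mk₂ ℝ (fun v w ↦ potentialForm γ ψ x v (nab σ x w))
        (by simp [potentialForm_add]) (by simp [potentialForm_smul]) (by simp)
        (by simp [ContinuousLinearMap.map_smul_of_tower]))
  have swapLL : ∑ j, potentialForm γ ψ x (coordDual e j x)
      (potentialForm γ ψ x (coordField e j x) (σ x)) =
      ∑ j, potentialForm γ ψ x (coordField e j x)
        (potentialForm γ ψ x (coordDual e j x) (σ x)) :=
    sum_coordDual_coordField_comm he (hUe hx)
      (LinearMap.mk₂ ℝ (fun v w ↦ potentialForm γ ψ x v (potentialForm γ ψ x w (σ x)))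
        (by simp [potentialForm_add]) (by simp [potentialForm_smul]) (by simp [potentialForm_add])
        (by simp [potentialForm_smul, ContinuousLinearMap.map_smul_of_tower]))
  have hDD (i : Fin d) : nab (diracOperator γ nab ψ σ) x (coordField e i x) =
      ∑ j, γ x (coordDual e j x) (H (coordField e i x) (coordField e j x))
        + nab (fun y ↦ ψ y (σ y)) x (coordField e i x) := by
    rw [hc.congr_on hU hx (hDσ.add hψσ) fun y hy ↦ diracOperator_eq_sum he (hUe hy),
      hc.fun_add hU hx hDσ hψσ, add_apply, hD.nab_sum_coordDual he hU hUe hσ hx hH]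
  have hlap (i : Fin d) : H' (coordField e i x) (coordDual e i x) = _ :=
    (hH' _ _ (hXd i) (hYd i)).symm.trans (hD.shiftedConnection_shiftedConnection hψ hU hσ hx (hY i))
  rw [diracOperator_eq_sum he (hUe hx), diracOperator_eq_sum he (hUe hx),
    laplacianInChart_eq_neg_sum he (hUe hx) hH', swap H', weitzenbockTerm, swapLL]
  simp only [hDD, hlap, hH _ _ (hXd _) (hYd _), map_add, map_sum, Finset.sum_add_distrib,
    Finset.sum_sub_distrib, ← Finset.smul_sum, curvature_eq_sub hH (hXd _) (hXd _)]
  rw [hD.isCliffordAction.sum_sum_coordDual he (hUe hx), swap H, ← swapL]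
  simp only [endConnection, potentialForm_apply (coordDual e _ x) (nab σ x (coordField e _ x)),
    map_sub, Finset.sum_add_distrib, Finset.sum_sub_distrib, ← Finset.smul_sum]
  module

/-- No transformation law is needed: in either chart the term is `D²σ` minus the Laplacian, and both
of these are independent of the chart. -/
theorem IsDiracBundle.weitzenbockTerm_eq [T2Space M] [ContMDiffVectorBundle ∞ F E (𝓡 d)]
    (hD : IsDiracBundle F γ nab) (hψ : IsSmoothEnd d F ψ)
    (he : e ∈ IsManifold.maximalAtlas (𝓡 d) ∞ M)
    {e' : OpenPartialHomeomorph M (EuclideanSpace ℝ (Fin d))}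
    (he' : e' ∈ IsManifold.maximalAtlas (𝓡 d) ∞ M) (hxe : x ∈ e.source) (hxe' : x ∈ e'.source)
    (hU : IsOpen U) (hσ : IsSmoothSectionOn d F σ U) (hx : x ∈ U) :
    weitzenbockTerm e γ nab ψ σ x = weitzenbockTerm e' γ nab ψ σ x := by
  have hS := isSmoothConnection_shiftedConnection hD.isCliffordAction hD.isSmoothConnection hψ
  have h1 := hD.diracOperator_diracOperator hψ he (hU.inter e.open_source) Set.inter_subset_right
    (hσ.mono Set.inter_subset_left) ⟨hx, hxe⟩
  rw [hD.diracOperator_diracOperator hψ he' (hU.inter e'.open_source) Set.inter_subset_right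
    (hσ.mono Set.inter_subset_left) ⟨hx, hxe'⟩, laplacianInChart_eq_laplacianInChart he hxe he'
    hxe' hS.isCovariantDerivative hS.contMDiff hU hσ hx] at h1
  exact (add_left_cancel h1).symm

end WeitzenbockFormula

/-! ### Smoothness and tensoriality of the potential -/

section Tensorial

variable {d : ℕ} {M : Type*} [TopologicalSpace M] [ChartedSpace (EuclideanSpace ℝ (Fin d)) M]
  {F : Type*} [NormedAddCommGroup F] [NormedSpace ℝ F]
  {V : M → Type*} [TopologicalSpace (TotalSpace F V)]
  [∀ x, AddCommGroup (V x)] [∀ x, Module ℝ (V x)] [∀ x, TopologicalSpace (V x)]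
  [FiberBundle F V] [VectorBundle ℝ F V]
  {A : Type*} [AddCommGroup A] [Module ℝ A]
  {P : (Π x : M, V x) → A} {σ τ : Π x : M, V x} {U : Set M} {x : M}

/-- An operator on germs of smooth sections which is linear over the smooth functions depends only
on the value of the section at the point. -/
theorem eq_of_smooth_tensorial [FiniteDimensional ℝ F] [ContMDiffVectorBundle ∞ F V (𝓡 d)]
    (hadd : ∀ (U : Set M) (σ τ : Π x : M, V x), IsOpen U → x ∈ U → IsSmoothSectionOn d F σ U →
      IsSmoothSectionOn d F τ U → P (fun y ↦ σ y + τ y) = P σ + P τ)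
    (hsmul : ∀ (U : Set M) (f : M → ℝ) (σ : Π x : M, V x), IsOpen U → x ∈ U →
      ContMDiffOn (𝓡 d) 𝓘(ℝ) ∞ f U → IsSmoothSectionOn d F σ U →
      P (fun y ↦ f y • σ y) = f x • P σ)
    (hU : IsOpen U) (hx : x ∈ U) (hσ : IsSmoothSectionOn d F σ U) (hτ : IsSmoothSectionOn d F τ U)
    (h : σ x = τ x) : P σ = P τ := by
  classical
  have hloc {W : Set M} {σ τ : Π x : M, V x} (hW : IsOpen W) (hxW : x ∈ W)
      (hσ : IsSmoothSectionOn d F σ W) (hστ : ∀ y ∈ W, τ y = σ y) : P τ = P σ := by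
    -- The multiplier has to be smooth only on `W`, so an indicator function serves: it is `1`
    -- there, and `f • σ = f • τ` everywhere. This gives locality of `P` without bump functions.
    let f : M → ℝ := W.indicator 1
    have hf1 : ∀ y ∈ W, f y = 1 := fun y hy ↦ Set.indicator_of_mem hy _
    have hf : ContMDiffOn (𝓡 d) 𝓘(ℝ) ∞ f W := contMDiffOn_const.congr hf1
    have h1 := hsmul W f σ hW hxW hf hσ
    have h2 := hsmul W f τ hW hxW hf (hσ.congr hστ)
    have h3 : (fun y ↦ f y • σ y) = fun y ↦ f y • τ y := by
      ext y
      by_cases hy : y ∈ W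
      · rw [hστ y hy]
      · simp [f, hy]
    rw [h3, h2, hf1 x hxW, one_smul, one_smul] at h1
    exact h1
  have hzero : P (fun _ ↦ 0) = 0 := by
    have h0 : IsSmoothSectionOn d F (fun y ↦ (0 : V y)) U := by
      simpa using hσ.const_smul 0
    simpa using hsmul U (fun _ ↦ 0) _ hU hx contMDiffOn_const h0
  have hsum {ι : Type} (s : Finset ι) {W : Set M} {t : ι → Π x : M, V x} (hW : IsOpen W)
      (hxW : x ∈ W) (ht : ∀ i, IsSmoothSectionOn d F (t i) W) :
      P (fun y ↦ ∑ i ∈ s, t i y) = ∑ i ∈ s, P (t i) := by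
    induction s using Finset.induction_on with
    | empty => simpa using hzero
    | insert a s ha ih =>
      simp only [Finset.sum_insert ha, ← ih]
      exact hadd W _ _ hW hxW (ht a) (IsSmoothSectionOn.sum fun i _ ↦ ht i)
  let t := trivializationAt F V x
  let b := finBasis ℝ F
  have hxt : x ∈ t.baseSet := FiberBundle.mem_baseSet_trivializationAt F V x
  have hW : IsOpen (U ∩ t.baseSet) := hU.inter t.open_baseSet
  have hb (i) : IsSmoothSectionOn d F (t.localFrame b i) (U ∩ t.baseSet) :=
    (t.contMDiffOn_localFrame_baseSet ∞ b i).mono Set.inter_subset_right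
  -- Expanding in a smooth local frame writes `P σ` through the coefficients of `σ` at `x` alone.
  have hP {σ : Π x : M, V x} (hσ : IsSmoothSectionOn d F σ U) :
      P σ = ∑ i, t.localFrameCoeff (𝓡 d) b i x (σ x) • P (t.localFrame b i) := by
    have hc (i) : ContMDiffOn (𝓡 d) 𝓘(ℝ) ∞
        (fun y ↦ t.localFrameCoeff (𝓡 d) b i y (σ y)) (U ∩ t.baseSet) :=
      contMDiffOn_localFrameCoeff b hW Set.inter_subset_right
        (hσ.mono Set.inter_subset_left) i
    rw [hloc (σ := fun y ↦ ∑ i, t.localFrameCoeff (𝓡 d) b i y (σ y) • t.localFrame b i y) hW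
      ⟨hx, hxt⟩ (IsSmoothSectionOn.sum fun i _ ↦ (hb i).smul (hc i))
      fun y hy ↦ t.eq_sum_localFrameCoeff_smul hy.2, hsum _ hW ⟨hx, hxt⟩
      fun i ↦ (hb i).smul (hc i)]
    exact Finset.sum_congr rfl fun i _ ↦ hsmul _ _ _ hW ⟨hx, hxt⟩ (hc i) (hb i)
  rw [hP hσ, hP hτ, h]

end Tensorial

/-! ### Linearity of the curvature and of the induced connection on endomorphisms -/

section CurvatureTensor

variable {d : ℕ} {M : Type*} [TopologicalSpace M]
  [ChartedSpace (EuclideanSpace ℝ (Fin d)) M] [IsManifold (𝓡 d) ∞ M]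
  {F : Type*} [NormedAddCommGroup F] [NormedSpace ℂ F]
  {E : M → Type*} [TopologicalSpace (TotalSpace F E)]
  [∀ x, AddCommGroup (E x)] [∀ x, Module ℂ (E x)] [∀ x, TopologicalSpace (E x)]
  [∀ x, IsTopologicalAddGroup (E x)] [∀ x, ContinuousSMul ℂ (E x)]
  [FiberBundle F E] [VectorBundle ℂ F E]
  {γ : Π x : M, TangentSpace (𝓡 d) x →ₗ[ℝ] (E x →L[ℂ] E x)}
  {nab : (Π x : M, E x) → Π x : M, TangentSpace (𝓡 d) x →L[ℝ] E x}
  {ψ : Π x : M, E x →L[ℂ] E x} {σ τ : Π x : M, E x} {U : Set M} {x : M}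
  {e : OpenPartialHomeomorph M (EuclideanSpace ℝ (Fin d))}

theorem curvature_coordField (he : e ∈ IsManifold.maximalAtlas (𝓡 d) ∞ M) (hx : x ∈ e.source)
    (i j : Fin d) : curvature nab (coordField e i) (coordField e j) σ x =
      nab (fun y ↦ nab σ y (coordField e j y)) x (coordField e i x)
        - nab (fun y ↦ nab σ y (coordField e i y)) x (coordField e j x) := by
  rw [curvature, mlieBracket_coordField he hx, map_zero, sub_zero]

namespace IsSmoothConnection

theorem isSmoothSectionOn_curvature [T2Space M] (hnab : IsSmoothConnection F nab)
    (he : e ∈ IsManifold.maximalAtlas (𝓡 d) ∞ M) (hU : IsOpen U) (hUe : U ⊆ e.source)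
    (hσ : IsSmoothSectionOn d F σ U) (i j : Fin d) :
    IsSmoothSectionOn d F (curvature nab (coordField e i) (coordField e j) σ) U := by
  have h (i : Fin d) {σ : Π x : M, E x} (hσ : IsSmoothSectionOn d F σ U) :
      IsSmoothSectionOn d F (fun y ↦ nab σ y (coordField e i y)) U :=
    hnab.isCovariantDerivative.isSmoothSectionOn_apply hnab.contMDiff hU hσ
      ((isSmoothSectionOn_coordField he i).mono hUe)
  exact ((h i (h j hσ)).sub (h j (h i hσ))).congr fun y hy ↦ curvature_coordField he (hUe hy) i j

theorem curvature_add [T2Space M] (hnab : IsSmoothConnection F nab)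
    (he : e ∈ IsManifold.maximalAtlas (𝓡 d) ∞ M) (hU : IsOpen U) (hUe : U ⊆ e.source)
    (hx : x ∈ U) (hσ : IsSmoothSectionOn d F σ U) (hτ : IsSmoothSectionOn d F τ U) (i j : Fin d) :
    curvature nab (coordField e i) (coordField e j) (fun y ↦ σ y + τ y) x =
      curvature nab (coordField e i) (coordField e j) σ x +
        curvature nab (coordField e i) (coordField e j) τ x := by
  have hc := hnab.isCovariantDerivative
  have h (i : Fin d) {σ : Π x : M, E x} (hσ : IsSmoothSectionOn d F σ U) :
      IsSmoothSectionOn d F (fun y ↦ nab σ y (coordField e i y)) U :=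
    hc.isSmoothSectionOn_apply hnab.contMDiff hU hσ ((isSmoothSectionOn_coordField he i).mono hUe)
  have h2 (i j : Fin d) : nab (fun y ↦ nab (fun y ↦ σ y + τ y) y (coordField e j y)) x
      (coordField e i x) = nab (fun y ↦ nab σ y (coordField e j y)) x (coordField e i x)
        + nab (fun y ↦ nab τ y (coordField e j y)) x (coordField e i x) := by
    rw [hc.congr_on hU hx ((h j hσ).add (h j hτ)) fun y hy ↦ by
      rw [hc.fun_add hU hy hσ hτ, add_apply], hc.fun_add hU hx (h j hσ) (h j hτ), add_apply]
  simp only [curvature_coordField he (hUe hx), h2]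
  abel

theorem curvature_smul [T2Space M] (hnab : IsSmoothConnection F nab)
    (he : e ∈ IsManifold.maximalAtlas (𝓡 d) ∞ M) (hU : IsOpen U) (hUe : U ⊆ e.source)
    (hx : x ∈ U) {f : M → ℝ} (hf : ContMDiffOn (𝓡 d) 𝓘(ℝ) ∞ f U) (hσ : IsSmoothSectionOn d F σ U)
    (i j : Fin d) :
    curvature nab (coordField e i) (coordField e j) (fun y ↦ f y • σ y) x =
      f x • curvature nab (coordField e i) (coordField e j) σ x := by
  have hc := hnab.isCovariantDerivative
  have h (i : Fin d) : IsSmoothSectionOn d F (fun y ↦ nab σ y (coordField e i y)) U :=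
    hc.isSmoothSectionOn_apply hnab.contMDiff hU hσ ((isSmoothSectionOn_coordField he i).mono hUe)
  have hf' (i : Fin d) := contMDiffOn_mvfderiv_coordField he hU hUe hf i
  -- Under antisymmetrization in `i` and `j` the two mixed terms cancel each other, and the second
  -- derivatives of `f` cancel because they commute.
  have h2 (i j : Fin d) : nab (fun y ↦ nab (fun y ↦ f y • σ y) y (coordField e j y)) x
      (coordField e i x) = f x • nab (fun y ↦ nab σ y (coordField e j y)) x (coordField e i x)
        + mvfderiv (𝓡 d) f x (coordField e i x) • nab σ x (coordField e j x)
        + (mvfderiv (𝓡 d) f x (coordField e j x) • nab σ x (coordField e i x)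
        + mvfderiv (𝓡 d) (fun y ↦ mvfderiv (𝓡 d) f y (coordField e j y)) x (coordField e i x)
          • σ x) := by
    rw [hc.congr_on hU hx (((h j).smul hf).add (hσ.smul (hf' j))) fun y hy ↦
      hc.fun_smul hU hy hf hσ _, hc.fun_add hU hx ((h j).smul hf) (hσ.smul (hf' j)), add_apply,
      hc.fun_smul hU hx hf (h j), hc.fun_smul hU hx (hf' j) hσ]
  simp only [curvature_coordField he (hUe hx), h2,
    mvfderiv_mvfderiv_coordField_comm he hU hUe hf hx i j]
  module

theorem const_csmul (hnab : IsSmoothConnection F nab) (hU : IsOpen U) (hx : x ∈ U) (c : ℂ)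
    (hσ : IsSmoothSectionOn d F σ U) (v : TangentSpace (𝓡 d) x) :
    nab (fun y ↦ c • σ y) x v = c • nab σ x v := by
  have h : mvfderiv (𝓡 d) (fun _ : M ↦ c) x v = 0 := by
    simp [mvfderiv]
  rw [hnab.complex_leibniz (f := fun _ ↦ c) (hσ.mdifferentiableAt hU hx) mdifferentiableAt_const v,
    h, zero_smul, add_zero]

theorem curvature_csmul [T2Space M] (hnab : IsSmoothConnection F nab)
    (he : e ∈ IsManifold.maximalAtlas (𝓡 d) ∞ M) (hU : IsOpen U) (hUe : U ⊆ e.source)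
    (hx : x ∈ U) (c : ℂ) (hσ : IsSmoothSectionOn d F σ U) (i j : Fin d) :
    curvature nab (coordField e i) (coordField e j) (fun y ↦ c • σ y) x =
      c • curvature nab (coordField e i) (coordField e j) σ x := by
  have hc := hnab.isCovariantDerivative
  have h (i : Fin d) : IsSmoothSectionOn d F (fun y ↦ nab σ y (coordField e i y)) U :=
    hc.isSmoothSectionOn_apply hnab.contMDiff hU hσ ((isSmoothSectionOn_coordField he i).mono hUe)
  have h2 (i j : Fin d) : nab (fun y ↦ nab (fun y ↦ c • σ y) y (coordField e j y)) x
      (coordField e i x) = c • nab (fun y ↦ nab σ y (coordField e j y)) x (coordField e i x) := by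
    rw [hc.congr_on hU hx ((h j).const_csmul c) fun y hy ↦ hnab.const_csmul hU hy c hσ _,
      hnab.const_csmul hU hx c (h j)]
  simp only [curvature_coordField he (hUe hx), h2, smul_sub]

theorem isSmoothSectionOn_endConnection [T2Space M] (hnab : IsSmoothConnection F nab)
    (hψ : IsSmoothEnd d F ψ) (hU : IsOpen U) {X : Π x : M, TangentSpace (𝓡 d) x}
    (hX : IsSmoothSectionOn d (EuclideanSpace ℝ (Fin d)) X U) (hσ : IsSmoothSectionOn d F σ U) :
    IsSmoothSectionOn d F (fun y ↦ endConnection nab ψ y (X y) σ) U := by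
  have h {σ : Π x : M, E x} (hσ : IsSmoothSectionOn d F σ U) :
      IsSmoothSectionOn d F (fun y ↦ nab σ y (X y)) U :=
    hnab.isCovariantDerivative.isSmoothSectionOn_apply hnab.contMDiff hU hσ hX
  exact (h (hψ.isSmoothSectionOn_apply hσ)).sub (hψ.isSmoothSectionOn_apply (h hσ))

theorem endConnection_add (hnab : IsSmoothConnection F nab) (hψ : IsSmoothEnd d F ψ)
    (hU : IsOpen U) (hx : x ∈ U) (hσ : IsSmoothSectionOn d F σ U) (hτ : IsSmoothSectionOn d F τ U)
    (v : TangentSpace (𝓡 d) x) : endConnection nab ψ x v (fun y ↦ σ y + τ y) =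
      endConnection nab ψ x v σ + endConnection nab ψ x v τ := by
  have hc := hnab.isCovariantDerivative
  simp only [endConnection, map_add]
  rw [hc.fun_add hU hx (hψ.isSmoothSectionOn_apply hσ) (hψ.isSmoothSectionOn_apply hτ),
    hc.fun_add hU hx hσ hτ, add_apply, add_apply, map_add]
  abel

theorem endConnection_smul (hnab : IsSmoothConnection F nab) (hψ : IsSmoothEnd d F ψ)
    (hU : IsOpen U) (hx : x ∈ U) {f : M → ℝ} (hf : ContMDiffOn (𝓡 d) 𝓘(ℝ) ∞ f U)
    (hσ : IsSmoothSectionOn d F σ U) (v : TangentSpace (𝓡 d) x) :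
    endConnection nab ψ x v (fun y ↦ f y • σ y) = f x • endConnection nab ψ x v σ := by
  have hc := hnab.isCovariantDerivative
  simp only [endConnection, ContinuousLinearMap.map_smul_of_tower]
  rw [hc.fun_smul hU hx hf (hψ.isSmoothSectionOn_apply hσ), hc.fun_smul hU hx hf hσ, map_add]
  simp only [ContinuousLinearMap.map_smul_of_tower, smul_sub]
  abel

theorem endConnection_csmul (hnab : IsSmoothConnection F nab) (hψ : IsSmoothEnd d F ψ)
    (hU : IsOpen U) (hx : x ∈ U) (c : ℂ) (hσ : IsSmoothSectionOn d F σ U)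
    (v : TangentSpace (𝓡 d) x) :
    endConnection nab ψ x v (fun y ↦ c • σ y) = c • endConnection nab ψ x v σ := by
  simp only [endConnection, map_smul]
  rw [hnab.const_csmul hU hx c (hψ.isSmoothSectionOn_apply hσ), hnab.const_csmul hU hx c hσ,
    map_smul, smul_sub]

end IsSmoothConnection

end CurvatureTensor

/-! ### The zeroth order term as a smooth endomorphism -/

section Potential

variable {d : ℕ} {M : Type*} [TopologicalSpace M] [T2Space M]
  [ChartedSpace (EuclideanSpace ℝ (Fin d)) M] [IsManifold (𝓡 d) ∞ M]
  [RiemannianBundle (fun x : M ↦ TangentSpace (𝓡 d) x)]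
  [IsContMDiffRiemannianBundle (𝓡 d) ∞ (EuclideanSpace ℝ (Fin d))
    (fun x : M ↦ TangentSpace (𝓡 d) x)]
  {F : Type*} [NormedAddCommGroup F] [NormedSpace ℂ F]
  {E : M → Type*} [TopologicalSpace (TotalSpace F E)]
  [∀ x, AddCommGroup (E x)] [∀ x, Module ℂ (E x)] [∀ x, TopologicalSpace (E x)]
  [∀ x, IsTopologicalAddGroup (E x)] [∀ x, ContinuousSMul ℂ (E x)]
  [FiberBundle F E] [VectorBundle ℂ F E]
  {γ : Π x : M, TangentSpace (𝓡 d) x →ₗ[ℝ] (E x →L[ℂ] E x)}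
  {nab : (Π x : M, E x) → Π x : M, TangentSpace (𝓡 d) x →L[ℝ] E x}
  {ψ : Π x : M, E x →L[ℂ] E x} {σ τ : Π x : M, E x} {U : Set M} {x : M}
  {e : OpenPartialHomeomorph M (EuclideanSpace ℝ (Fin d))}

namespace IsDiracBundle

theorem isSmoothSectionOn_weitzenbockTerm (hD : IsDiracBundle F γ nab) (hψ : IsSmoothEnd d F ψ)
    (he : e ∈ IsManifold.maximalAtlas (𝓡 d) ∞ M) (hU : IsOpen U) (hUe : U ⊆ e.source)
    (hσ : IsSmoothSectionOn d F σ U) :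
    IsSmoothSectionOn d F (weitzenbockTerm e γ nab ψ σ) U := by
  have hγ := hD.isCliffordAction
  have hnab := hD.isSmoothConnection
  have hX (j : Fin d) := (isSmoothSectionOn_coordField he j).mono hUe
  have hY (j : Fin d) := (isSmoothSectionOn_coordDual he j).mono hUe
  have h1 : IsSmoothSectionOn d F (fun y ↦ (1 / 2 : ℝ) • ∑ i, ∑ j, γ y (coordDual e i y)
      (γ y (coordDual e j y) (curvature nab (coordField e i) (coordField e j) σ y))) U :=
    (IsSmoothSectionOn.sum fun i _ ↦ IsSmoothSectionOn.sum fun j _ ↦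
      hγ.isSmoothSectionOn_apply (hY i) (hγ.isSmoothSectionOn_apply (hY j)
        (hnab.isSmoothSectionOn_curvature he hU hUe hσ i j))).const_smul _
  have h2 : IsSmoothSectionOn d F (fun x ↦ (1 / 2 : ℝ) • ∑ i,
      (γ x (coordDual e i x) (endConnection nab ψ x (coordField e i x) σ)
        - endConnection nab ψ x (coordField e i x) (fun y ↦ γ y (coordDual e i y) (σ y)))) U :=
    (IsSmoothSectionOn.sum fun i _ ↦
      (hγ.isSmoothSectionOn_apply (hY i)
        (hnab.isSmoothSectionOn_endConnection hψ hU (hX i) hσ)).sub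
      (hnab.isSmoothSectionOn_endConnection hψ hU (hX i)
        (hγ.isSmoothSectionOn_apply (hY i) hσ))).const_smul _
  have h3 : IsSmoothSectionOn d F (fun x ↦ ∑ i, potentialForm γ ψ x (coordDual e i x)
      (potentialForm γ ψ x (coordField e i x) (σ x))) U :=
    IsSmoothSectionOn.sum fun i _ ↦ isSmoothSectionOn_potentialForm hγ hψ (hY i)
      (isSmoothSectionOn_potentialForm hγ hψ (hX i) hσ)
  exact ((h1.add h2).add h3).add (hψ.isSmoothSectionOn_apply (hψ.isSmoothSectionOn_apply hσ))

theorem weitzenbockTerm_add (hD : IsDiracBundle F γ nab) (hψ : IsSmoothEnd d F ψ)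
    (he : e ∈ IsManifold.maximalAtlas (𝓡 d) ∞ M) (hU : IsOpen U) (hUe : U ⊆ e.source) (hx : x ∈ U)
    (hσ : IsSmoothSectionOn d F σ U) (hτ : IsSmoothSectionOn d F τ U) :
    weitzenbockTerm e γ nab ψ (fun y ↦ σ y + τ y) x =
      weitzenbockTerm e γ nab ψ σ x + weitzenbockTerm e γ nab ψ τ x := by
  have hγ := hD.isCliffordAction
  have hnab := hD.isSmoothConnection
  have hY (j : Fin d) := (isSmoothSectionOn_coordDual he j).mono hUe
  simp only [weitzenbockTerm, map_add, hnab.curvature_add he hU hUe hx hσ hτ,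
    hnab.endConnection_add hψ hU hx hσ hτ,
    hnab.endConnection_add hψ hU hx (hγ.isSmoothSectionOn_apply (hY _) hσ)
      (hγ.isSmoothSectionOn_apply (hY _) hτ), Finset.sum_add_distrib, Finset.sum_sub_distrib]
  module

theorem weitzenbockTerm_smul (hD : IsDiracBundle F γ nab) (hψ : IsSmoothEnd d F ψ)
    (he : e ∈ IsManifold.maximalAtlas (𝓡 d) ∞ M) (hU : IsOpen U) (hUe : U ⊆ e.source) (hx : x ∈ U)
    {f : M → ℝ} (hf : ContMDiffOn (𝓡 d) 𝓘(ℝ) ∞ f U) (hσ : IsSmoothSectionOn d F σ U) :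
    weitzenbockTerm e γ nab ψ (fun y ↦ f y • σ y) x = f x • weitzenbockTerm e γ nab ψ σ x := by
  have hγ := hD.isCliffordAction
  have hnab := hD.isSmoothConnection
  have hY (j : Fin d) := (isSmoothSectionOn_coordDual he j).mono hUe
  simp only [weitzenbockTerm, ContinuousLinearMap.map_smul_of_tower,
    hnab.curvature_smul he hU hUe hx hf hσ, hnab.endConnection_smul hψ hU hx hf hσ,
    hnab.endConnection_smul hψ hU hx hf (hγ.isSmoothSectionOn_apply (hY _) hσ),
    ← smul_sub, ← Finset.smul_sum, smul_add, smul_comm (f x) (1 / 2 : ℝ)]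

/-- Tensoriality over real functions gives only a real-linear map on each fibre; this supplies
complex linearity. -/
theorem weitzenbockTerm_csmul (hD : IsDiracBundle F γ nab) (hψ : IsSmoothEnd d F ψ)
    (he : e ∈ IsManifold.maximalAtlas (𝓡 d) ∞ M) (hU : IsOpen U) (hUe : U ⊆ e.source) (hx : x ∈ U)
    (c : ℂ) (hσ : IsSmoothSectionOn d F σ U) :
    weitzenbockTerm e γ nab ψ (fun y ↦ c • σ y) x = c • weitzenbockTerm e γ nab ψ σ x := by
  have hγ := hD.isCliffordAction
  have hnab := hD.isSmoothConnection
  have hY (j : Fin d) := (isSmoothSectionOn_coordDual he j).mono hUe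
  simp only [weitzenbockTerm, map_smul, hnab.curvature_csmul he hU hUe hx c hσ,
    hnab.endConnection_csmul hψ hU hx c hσ,
    hnab.endConnection_csmul hψ hU hx c (hγ.isSmoothSectionOn_apply (hY _) hσ),
    ← smul_sub, ← Finset.smul_sum, smul_add, smul_comm c (1 / 2 : ℝ)]

variable [FiniteDimensional ℂ F] [ContMDiffVectorBundle ∞ F E (𝓡 d)]

theorem weitzenbockTerm_congr (hD : IsDiracBundle F γ nab) (hψ : IsSmoothEnd d F ψ)
    (he : e ∈ IsManifold.maximalAtlas (𝓡 d) ∞ M) (hxe : x ∈ e.source) (hU : IsOpen U) (hx : x ∈ U)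
    (hσ : IsSmoothSectionOn d F σ U) (hτ : IsSmoothSectionOn d F τ U) (h : σ x = τ x) :
    weitzenbockTerm e γ nab ψ σ x = weitzenbockTerm e γ nab ψ τ x := by
  have : FiniteDimensional ℝ F := FiniteDimensional.complexToReal F
  refine eq_of_smooth_tensorial (P := fun σ ↦ weitzenbockTerm e γ nab ψ σ x)
    (fun W σ τ hW hxW hσ hτ ↦ ?_) (fun W f σ hW hxW hf hσ ↦ ?_) hU hx hσ hτ h
  · exact hD.weitzenbockTerm_add hψ he (hW.inter e.open_source) Set.inter_subset_right ⟨hxW, hxe⟩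
      (hσ.mono Set.inter_subset_left) (hτ.mono Set.inter_subset_left)
  · exact hD.weitzenbockTerm_smul hψ he (hW.inter e.open_source) Set.inter_subset_right ⟨hxW, hxe⟩
      (hf.mono Set.inter_subset_left) (hσ.mono Set.inter_subset_left)

/-- The zeroth order term in the Weitzenböck formula, as a field of endomorphisms. -/
theorem exists_potential (hD : IsDiracBundle F γ nab) (hψ : IsSmoothEnd d F ψ) :
    ∃ V : Π x : M, E x →L[ℂ] E x, ∀ e ∈ IsManifold.maximalAtlas (𝓡 d) ∞ M,
      ∀ (U : Set M) (σ : Π x : M, E x), IsOpen U → IsSmoothSectionOn d F σ U →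
        ∀ x ∈ U, x ∈ e.source → V x (σ x) = weitzenbockTerm e γ nab ψ σ x := by
  suffices h : ∀ x : M, ∃ V : E x →L[ℂ] E x, ∀ e ∈ IsManifold.maximalAtlas (𝓡 d) ∞ M,
      ∀ (U : Set M) (σ : Π x : M, E x), IsOpen U → IsSmoothSectionOn d F σ U →
        x ∈ U → x ∈ e.source → V (σ x) = weitzenbockTerm e γ nab ψ σ x by
    choose V hV using h
    exact ⟨V, fun e he U σ hU hσ x hx hxe ↦ hV x e he U σ hU hσ hx hxe⟩
  intro x
  -- On a Hausdorff finite-dimensional fibre every linear map is continuous.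
  have : T2Space (E x) := FiberBundle.t2Space F E x
  have : FiniteDimensional ℂ (E x) := VectorBundle.finiteDimensional ℂ F E x
  set c := chartAt (EuclideanSpace ℝ (Fin d)) x
  have hc : c ∈ IsManifold.maximalAtlas (𝓡 d) ∞ M := IsManifold.chart_mem_maximalAtlas x
  have hxc : x ∈ c.source := mem_chart_source _ x
  set t := trivializationAt F E x
  have hxt : x ∈ t.baseSet := FiberBundle.mem_baseSet_trivializationAt F E x
  have hU : IsOpen (t.baseSet ∩ c.source) := t.open_baseSet.inter c.open_source
  have hs (w : E x) : IsSmoothSectionOn d F (extend F w) (t.baseSet ∩ c.source) :=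
    (isSmoothSectionOn_extend w).mono Set.inter_subset_left
  -- The value at `w` is the term in the preferred chart, evaluated on some local extension of `w`.
  -- Tensoriality removes the choice of extension, which also yields linearity, and
  -- `weitzenbockTerm_eq` removes the choice of chart.
  refine ⟨LinearMap.toContinuousLinearMap
    { toFun := fun w ↦ weitzenbockTerm c γ nab ψ (extend F w) x
      map_add' := fun v w ↦ ?_
      map_smul' := fun a w ↦ ?_ }, fun e he U σ hUo hσ hx hxe ↦ ?_⟩
  · rw [← hD.weitzenbockTerm_add hψ hc hU Set.inter_subset_right ⟨hxt, hxc⟩ (hs v) (hs w)]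
    exact hD.weitzenbockTerm_congr hψ hc hxc hU ⟨hxt, hxc⟩ (hs _) ((hs v).add (hs w)) (by simp)
  · rw [RingHom.id_apply,
      ← hD.weitzenbockTerm_csmul hψ hc hU Set.inter_subset_right ⟨hxt, hxc⟩ a (hs w)]
    exact hD.weitzenbockTerm_congr hψ hc hxc hU ⟨hxt, hxc⟩ (hs _) ((hs w).const_csmul a) (by simp)
  · rw [hD.weitzenbockTerm_eq hψ he hc hxe hxc hUo hσ hx]
    exact hD.weitzenbockTerm_congr hψ hc hxc (hUo.inter hU) ⟨hx, hxt, hxc⟩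
      ((hs _).mono Set.inter_subset_right) (hσ.mono Set.inter_subset_left) (by simp)

/-- Smoothness of `V` is tested on local sections, whose images are the smooth terms
`weitzenbockTerm` near each point. For this reason `hV` covers sections smooth only on an open set.
-/
theorem isSmoothEnd_potential (hD : IsDiracBundle F γ nab) (hψ : IsSmoothEnd d F ψ)
    {V : Π x : M, E x →L[ℂ] E x} (hV : ∀ e ∈ IsManifold.maximalAtlas (𝓡 d) ∞ M,
      ∀ (U : Set M) (σ : Π x : M, E x), IsOpen U → IsSmoothSectionOn d F σ U →
        ∀ x ∈ U, x ∈ e.source → V x (σ x) = weitzenbockTerm e γ nab ψ σ x) :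
    IsSmoothEnd d F V := by
  have : FiniteDimensional ℝ F := FiniteDimensional.complexToReal F
  suffices h : IsSmoothSectionOn d (F →L[ℝ] F) (fun x ↦ (V x).restrictScalars ℝ) Set.univ from
    contMDiffOn_univ.1 h
  refine isSmoothSectionOn_hom isOpen_univ fun W _ hW s hs ↦
    IsSmoothSectionOn.of_forall_mem_nhds fun x hx ↦ ?_
  set c := chartAt (EuclideanSpace ℝ (Fin d)) x
  have hc : c ∈ IsManifold.maximalAtlas (𝓡 d) ∞ M := IsManifold.chart_mem_maximalAtlas x
  have hU : IsOpen (W ∩ c.source) := hW.inter c.open_source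
  refine ⟨W ∩ c.source, hU.mem_nhds ⟨hx, mem_chart_source _ x⟩, ?_⟩
  exact (hD.isSmoothSectionOn_weitzenbockTerm hψ hc hU Set.inter_subset_right
    (hs.mono Set.inter_subset_left)).congr fun y hy ↦ hV c hc W s hW hs y hy.1 hy.2

end IsDiracBundle

end Potential

end

theorem mainTheorem9 {d : ℕ} {M : Type*} [TopologicalSpace M] [T2Space M]
    [ChartedSpace (EuclideanSpace ℝ (Fin d)) M] [IsManifold (𝓡 d) ∞ M]
    [RiemannianBundle (fun x : M ↦ TangentSpace (𝓡 d) x)]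
    [IsContMDiffRiemannianBundle (𝓡 d) ∞ (EuclideanSpace ℝ (Fin d))
      (fun x : M ↦ TangentSpace (𝓡 d) x)]
    {F : Type*} [NormedAddCommGroup F] [NormedSpace ℂ F] [FiniteDimensional ℂ F]
    {E : M → Type*} [TopologicalSpace (TotalSpace F E)]
    [∀ x, AddCommGroup (E x)] [∀ x, Module ℂ (E x)] [∀ x, TopologicalSpace (E x)]
    [∀ x, IsTopologicalAddGroup (E x)] [∀ x, ContinuousSMul ℂ (E x)]
    [FiberBundle F E] [VectorBundle ℂ F E] [ContMDiffVectorBundle ∞ F E (𝓡 d)]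
    (γ : Π x : M, TangentSpace (𝓡 d) x →ₗ[ℝ] (E x →L[ℂ] E x))
    (nab : (Π x : M, E x) → Π x : M, TangentSpace (𝓡 d) x →L[ℝ] E x)
    (hDirac : IsDiracBundle F γ nab)
    (ψ : Π x : M, E x →L[ℂ] E x) (hψ : IsSmoothEnd d F ψ) :
    IsSmoothConnection F (shiftedConnection γ nab ψ) ∧
    ∃ V : Π x : M, E x →L[ℂ] E x, IsSmoothEnd d F V ∧
      (∀ σ : Π x : M, E x, IsSmoothSection d F σ → ∀ x : M,
        diracOperator γ nab ψ (diracOperator γ nab ψ σ) x =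
          connectionLaplacian (shiftedConnection γ nab ψ) σ x + V x (σ x)) ∧
      ∀ e ∈ IsManifold.maximalAtlas (𝓡 d) ∞ M, ∀ σ : Π x : M, E x, IsSmoothSection d F σ →
        ∀ x ∈ e.source,
          connectionLaplacian (shiftedConnection γ nab ψ) σ x =
            laplacianInChart e (shiftedConnection γ nab ψ) σ x ∧
          V x (σ x) = weitzenbockTerm e γ nab ψ σ x := by
  have hS := isSmoothConnection_shiftedConnection hDirac.isCliffordAction
    hDirac.isSmoothConnection hψ
  have hlap : ∀ e ∈ IsManifold.maximalAtlas (𝓡 d) ∞ M, ∀ σ : Π x : M, E x,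
      IsSmoothSection d F σ → ∀ x ∈ e.source,
        connectionLaplacian (shiftedConnection γ nab ψ) σ x =
          laplacianInChart e (shiftedConnection γ nab ψ) σ x := fun e he σ hσ x hx ↦
    laplacianInChart_eq_laplacianInChart (IsManifold.chart_mem_maximalAtlas x)
      (mem_chart_source _ x) he hx hS.isCovariantDerivative hS.contMDiff isOpen_univ
      hσ.contMDiffOn (Set.mem_univ x)
  obtain ⟨V, hV⟩ := hDirac.exists_potential hψ
  refine ⟨hS, V, hDirac.isSmoothEnd_potential hψ hV, fun σ hσ x ↦ ?_, fun e he σ hσ x hx ↦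
    ⟨hlap e he σ hσ x hx, hV e he _ σ isOpen_univ hσ.contMDiffOn x (Set.mem_univ x) hx⟩⟩
  set c := chartAt (EuclideanSpace ℝ (Fin d)) x
  have hc : c ∈ IsManifold.maximalAtlas (𝓡 d) ∞ M := IsManifold.chart_mem_maximalAtlas x
  have hxc : x ∈ c.source := mem_chart_source _ x
  rw [hV c hc _ σ isOpen_univ hσ.contMDiffOn x (Set.mem_univ x) hxc]
  -- `connectionLaplacian` at `x` is by definition the expression in the preferred chart `c`, so the
  -- formula in that chart is the claim.
  exact hDirac.diracOperator_diracOperator hψ hc c.open_source subset_rfl hσ.contMDiffOn hxc
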